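/- **Setting.** Let $n\ge 1$, $d\ge 0$. Let $W=[w_{ij}]\in\mathbb R^{n\times n}$ be doubly stochastic, symmetric, primitive and positive semidefinite, and let $\lambda=\rho(W-\tfrac1n\mathbf 1\mathbf 1^{\mathsf T})<1$ be its mixing rate. Let $f_1,\dots,f_n:\mathbb R^d\to\mathbb R$ be $L$-smooth (differentiable with $\|\nabla f_i(z)-\nabla f_i(y)\|\le L\|z-y\|$ for all $z,y$), $L>0$, let $f=\frac1n\sum_{i=1}^n f_i$ be bounded below with $f^\star=\inf f$, and let $f$ satisfy the Polyak–Łojasiewicz inequality $2\mu(f(x)-f^\star)\le\|\nabla f(x)\|^2$ for all $x$, where $0<\mu\le L$ (the bound $\mu\le L$ is automatic unless $f$ is constant). Stochastic ATC-GT (adapt-then-combine gradient tracking) with step size $\alpha$ starts at $x_i^0=x^0\in\mathbb R^d$ for all $i$ and $g_i^0=\sum_j w_{ij}\nabla F_j(x^0;\xi_j^0)$, and iterates $$x_i^{k+1}=\sum_j w_{ij}\,(x_j^k-\alpha g_j^k),\qquad g_i^{k+1}=\sum_j w_{ij}\big(g_j^k+\nabla F_j(x_j^{k+1};\xi_j^{k+1})-\nabla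 F_j(x_j^k;\xi_j^k)\big),$$ where $\nabla F_i(\cdot\,;\xi_i^k)$ is a stochastic gradient. With $\mathcal F^k=\sigma(\mathbf x^0,\dots,\mathbf x^k)$, $\mathbf x^k=(x_1^k,\dots,x_n^k)$, assume for all $i,k$ that the noise $w_i^k=\nabla F_i(x_i^k;\xi_i^k)-\nabla f_i(x_i^k)$ is square integrable with $\mathbb E[w_i^k\mid\mathcal F^k]=0$ and $\mathbb E[\|w_i^k\|^2\mid\mathcal F^k]\le\sigma^2$, and that $\xi_1^k,\dots,\xi_n^k$ are conditionally independent given $\mathcal F^k$. Put $\zeta_0^2=\frac1n\sum_{i=1}^n\big\|\sum_j [W^2]_{ij}\nabla f_j(x^0)-\nabla f(x^0)\big\|^2$. Call $\alpha>0$ *admissible* if $$\alpha\le\min\left\{\frac{1-\lambda}{6L},\ \frac{1-\lambda}{6\sqrt{18}\,L\lambda^2},\ \Big(\frac{\mu(1-\lambda)^3}{432L^4}\Big)^{1/3}\right\},$$ the second entry being $+\infty$ if $\lambda=0$. **(1)** There is a universal constant $C$ such that, for every admissible $\alpha$ and every $k\ge0$, all $f(x_i^k)$ are integrable and $$\frac1n\sum_{i=1}^n\mathbb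 E[f(x_i^k)-f^\star]\le\Big(1-\frac{\alpha\mu}2\Big)^k r_0+C\left(\frac{\alpha L\sigma^2}{\mu n}+\frac{\alpha^2L^2\lambda^4\sigma^2}{\mu(1-\lambda)}+\frac{\alpha^4L^4\lambda^4\sigma^2}{\mu(1-\lambda)^4n}\right),$$ where $r_0=2(f(x^0)-f^\star)+27\alpha^2L\zeta_0^2/(1-\lambda)^2$. **(2)** There are a universal $p\in\mathbb N$ and a constant $C(\mu,L)$ depending only on $\mu,L$ such that, whenever $\alpha=2\ln(K^2)/(\mu K)$ is admissible, $$\frac1n\sum_{i=1}^n\mathbb E[f(x_i^K)-f^\star]\le\frac{2(f(x^0)-f^\star)}{K^2}+C(\mu,L)(\ln K)^p\left(\frac{\sigma^2}{Kn}+\frac{\lambda^4\sigma^2}{K^2(1-\lambda)}+\frac{\zeta_0^2}{K^4(1-\lambda)^2}+\frac{\lambda^4\sigma^2}{K^4(1-\lambda)^4n}\right).$$ **(3)** (Transient time $O(\max\{\frac n{1-\lambda},\frac1{(1-\lambda)^{4/3}}\})$.) There are a universal $p\in\mathbb N$, a constant $C(\mu,L)$ depending only on $\mu,L$, and a constant $c(\mu,L,D)$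 depending only on $\mu,L,D$ such that, for every real $D$ and every $$K\ge c(\mu,L,D)\,\max\left\{\frac n{1-\lambda},\frac1{(1-\lambda)^{4/3}}\right\},$$ the step size $\alpha=2\ln(K^2)/(\mu K)$ is admissible, and, if moreover $f(x^0)-f^\star\le D\sigma^2$ and $\zeta_0^2\le D\sigma^2$, the linear-speedup term dominates: $$\frac1n\sum_{i=1}^n\mathbb E[f(x_i^K)-f^\star]\le C(\mu,L)(\ln K)^p\,\frac{\sigma^2}{nK}.$$ -/

import Mathlib

open MeasureTheory ProbabilityTheory Filter

universe u v

noncomputable section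

/-- The decision space `ℝ^d` with its Euclidean norm. -/
abbrev Vec (d : ℕ) : Type := EuclideanSpace ℝ (Fin d)

/-! ### The network -/

/-- A combination matrix: doubly stochastic, symmetric and primitive. -/
structure IsCombinationMatrix {n : ℕ} (W : Matrix (Fin n) (Fin n) ℝ) : Prop where
  stochastic : W ∈ doublyStochastic ℝ (Fin n)
  symm : W.IsSymm
  primitive : W.IsPrimitive

/-- The mixing rate `λ = ρ(W - (1/n) 𝟙 𝟙ᵀ)`. All matrices to which it is applied are real symmetric,
so that all their eigenvalues are real. -/
def mixingRate {n : ℕ} (W : Matrix (Fin n) (Fin n) ℝ) : ℝ :=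
  (spectralRadius ℝ (W - Matrix.of fun _ _ => (1 / (n : ℝ)))).toReal

/-! ### The objective -/

/-- The aggregate cost `f(x) = (1/n) ∑ i, f i x`. -/
def avgCost {n d : ℕ} (f : Fin n → Vec d → ℝ) (x : Vec d) : ℝ :=
  (1 / (n : ℝ)) * ∑ i, f i x

/-- The optimal value `f⋆` of the aggregate cost. -/
def optValue {n d : ℕ} (f : Fin n → Vec d → ℝ) : ℝ :=
  ⨅ x, avgCost f x

/-- Every `f i` is `L`-smooth, with `L > 0`, and the aggregate cost is bounded below. -/
structure IsSmoothObjective {n d : ℕ} (f : Fin n → Vec d → ℝ) (L : ℝ) : Prop where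
  pos : 0 < L
  differentiable : ∀ i, Differentiable ℝ (f i)
  lipschitz : ∀ i z y, ‖gradient (f i) z - gradient (f i) y‖ ≤ L * ‖z - y‖
  bddBelow : BddBelow (Set.range (avgCost f))

/-- The Polyak-Łojasiewicz inequality for the aggregate cost, with constant `μ > 0`. -/
structure IsPL {n d : ℕ} (f : Fin n → Vec d → ℝ) (μ : ℝ) : Prop where
  pos : 0 < μ
  ineq : ∀ x, 2 * μ * (avgCost f x - optValue f) ≤ ‖gradient (avgCost f) x‖ ^ 2

/-- `ζ₀² = (1/n) ∑ i, ‖∑ j, [W²]ᵢⱼ ∇fⱼ(x⁰) - ∇f(x⁰)‖²`. -/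
def zetaSq {n d : ℕ} (W : Matrix (Fin n) (Fin n) ℝ) (f : Fin n → Vec d → ℝ) (x0 : Vec d) : ℝ :=
  (1 / (n : ℝ)) *
    ∑ i, ‖∑ j, (W ^ 2) i j • gradient (f j) x0 - gradient (avgCost f) x0‖ ^ 2

/-! ### The algorithm -/

/-- The stacked stochastic gradient `i ↦ ∇F i (x i; ξ i k)` at time `k` and outcome `ω`. -/
def stochGrad {n d : ℕ} {Ω : Type*} {Ξ : Fin n → Type*} (F : (i : Fin n) → Vec d → Ξ i → ℝ)
    (ξ : (i : Fin n) → ℕ → Ω → Ξ i) (ω : Ω) (k : ℕ) (x : Fin n → Vec d) : Fin n → Vec d :=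
  fun i => gradient (fun z => F i z (ξ i k ω)) (x i)

/-- Stochastic ATC gradient tracking with step size `α` and common starting point `x0`. The state at
time `k` is the pair (iterates `xᵢᵏ`, trackers `gᵢᵏ`); at time zero `xᵢ⁰ = x0` and
`gᵢ⁰ = ∑ j, wᵢⱼ ∇Fⱼ(x0; ξⱼ⁰)`. -/
def atcGT {n d : ℕ} {Ω : Type*} {Ξ : Fin n → Type*} (W : Matrix (Fin n) (Fin n) ℝ)
    (F : (i : Fin n) → Vec d → Ξ i → ℝ) (ξ : (i : Fin n) → ℕ → Ω → Ξ i)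
    (x0 : Vec d) (α : ℝ) (ω : Ω) : ℕ → (Fin n → Vec d) × (Fin n → Vec d)
  | 0 => (fun _ => x0, fun i => ∑ j, W i j • stochGrad F ξ ω 0 (fun _ => x0) j)
  | k + 1 =>
    let x := (atcGT W F ξ x0 α ω k).1
    let g := (atcGT W F ξ x0 α ω k).2
    let x' : Fin n → Vec d := fun i => ∑ j, W i j • (x j - α • g j)
    (x', fun i => ∑ j, W i j • (g j + stochGrad F ξ ω (k + 1) x' j - stochGrad F ξ ω k x j))

/-- The iterates `x^k = (x₁ᵏ, …, xₙᵏ)` of stochastic ATC-GT. -/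
def atcGTIterate {n d : ℕ} {Ω : Type*} {Ξ : Fin n → Type*} (W : Matrix (Fin n) (Fin n) ℝ)
    (F : (i : Fin n) → Vec d → Ξ i → ℝ) (ξ : (i : Fin n) → ℕ → Ω → Ξ i)
    (x0 : Vec d) (α : ℝ) (k : ℕ) (ω : Ω) : Fin n → Vec d :=
  (atcGT W F ξ x0 α ω k).1

/-! ### The gradient noise -/

/-- The σ-algebra generated by `x 0, …, x k`. -/
abbrev pastSigma {n d : ℕ} {Ω : Type*} (x : ℕ → Ω → Fin n → Vec d) (k : ℕ) : MeasurableSpace Ω :=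
  ⨆ (j : ℕ) (_ : j ≤ k), MeasurableSpace.comap (x j) inferInstance

/-- Conditional independence, given `m`, of a finite family of random variables, on an arbitrary
probability space (Mathlib's `iCondIndepFun` needs a standard Borel space, where it says the same by
`iCondIndepFun_iff_condExp_inter_preimage_eq_mul`). -/
def CondIndepFamily {n : ℕ} {Ω : Type*} (m : MeasurableSpace Ω) [MeasurableSpace Ω]
    {Ξ : Fin n → Type*} [∀ i, MeasurableSpace (Ξ i)] (P : Measure Ω)
    (ξ : (i : Fin n) → Ω → Ξ i) : Prop :=
  ∀ (S : Finset (Fin n)) (A : (i : Fin n) → Set (Ξ i)), (∀ i ∈ S, MeasurableSet (A i)) →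
    P⟦⋂ i ∈ S, ξ i ⁻¹' A i | m⟧ =ᵐ[P] ∏ i ∈ S, P⟦ξ i ⁻¹' A i | m⟧

/-- The noise `∇F i (xᵢᵏ; ξᵢᵏ) - ∇f i (xᵢᵏ)` of agent `i` at time `k` along a trajectory `x`. -/
def gradNoise {n d : ℕ} {Ω : Type*} {Ξ : Fin n → Type*} (f : Fin n → Vec d → ℝ)
    (F : (i : Fin n) → Vec d → Ξ i → ℝ) (ξ : (i : Fin n) → ℕ → Ω → Ξ i)
    (x : ℕ → Ω → Fin n → Vec d) (i : Fin n) (k : ℕ) (ω : Ω) : Vec d :=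
  stochGrad F ξ ω k (x k ω) i - gradient (f i) (x k ω i)

/-- The noise along the trajectory `x` is conditionally unbiased with conditional variance at most
`σ²` given the past iterates, and the samples of the different agents at time `k` are conditionally
independent given the past iterates. The first three fields make the conditional expectations
meaningful. -/
structure NoiseAssumption {n d : ℕ} {Ω : Type*} [MeasurableSpace Ω] {Ξ : Fin n → Type*}
    [∀ i, MeasurableSpace (Ξ i)] (P : Measure Ω) (f : Fin n → Vec d → ℝ)
    (F : (i : Fin n) → Vec d → Ξ i → ℝ) (ξ : (i : Fin n) → ℕ → Ω → Ξ i)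
    (x : ℕ → Ω → Fin n → Vec d) (σ : ℝ) : Prop where
  measurable_sample : ∀ i k, Measurable (ξ i k)
  measurable_grad : ∀ i, Measurable fun q : Vec d × Ξ i => gradient (fun z => F i z q.2) q.1
  memLp : ∀ i k, MemLp (gradNoise f F ξ x i k) 2 P
  unbiased : ∀ i k, P[gradNoise f F ξ x i k | pastSigma x k] =ᵐ[P] 0
  variance : ∀ i k,
    P[fun ω => ‖gradNoise f F ξ x i k ω‖ ^ 2 | pastSigma x k] ≤ᵐ[P] fun _ => σ ^ 2
  condIndep : ∀ k, CondIndepFamily (pastSigma x k) P fun i => ξ i k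

/-! ### Standing assumptions, step sizes and error -/

/-- The standing assumptions on the network, the objective and the noise of stochastic ATC-GT run
with step size `α` from `x0`. The inequality `μ ≤ L` is automatic unless the aggregate cost is
constant. -/
structure StandingAssumptions {n d : ℕ} {Ω : Type*} [MeasurableSpace Ω] {Ξ : Fin n → Type*}
    [∀ i, MeasurableSpace (Ξ i)] (P : Measure Ω) (W : Matrix (Fin n) (Fin n) ℝ)
    (f : Fin n → Vec d → ℝ) (F : (i : Fin n) → Vec d → Ξ i → ℝ)
    (ξ : (i : Fin n) → ℕ → Ω → Ξ i) (x0 : Vec d) (L μ σ α : ℝ) : Prop where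
  one_le : 1 ≤ n
  combination : IsCombinationMatrix W
  posSemidef : W.PosSemidef
  smooth : IsSmoothObjective f L
  pl : IsPL f μ
  mu_le : μ ≤ L
  noise : NoiseAssumption P f F ξ (atcGTIterate W F ξ x0 α) σ

/-- The step-size condition. The second threshold is void when the mixing rate `l` is zero. -/
structure StepSizeOK (L μ l α : ℝ) : Prop where
  pos : 0 < α
  le_first : α ≤ (1 - l) / (6 * L)
  le_second : l ≠ 0 → α ≤ (1 - l) / (6 * √18 * L * l ^ 2)
  le_third : α ≤ (μ * (1 - l) ^ 3 / (432 * L ^ 4)) ^ (1 / 3 : ℝ)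

/-- The step size `2 ln(K²) / (μ K)`. -/
def logStep (μ : ℝ) (K : ℕ) : ℝ := 2 * Real.log ((K : ℝ) ^ 2) / (μ * K)

/-- The error `(1/n) ∑ i, E[f(xᵢᵏ) - f⋆]` of ATC-GT after `k` iterations. -/
def expectedError {n d : ℕ} {Ω : Type*} [MeasurableSpace Ω] {Ξ : Fin n → Type*}
    (P : Measure Ω) (W : Matrix (Fin n) (Fin n) ℝ)
    (f : Fin n → Vec d → ℝ) (F : (i : Fin n) → Vec d → Ξ i → ℝ)
    (ξ : (i : Fin n) → ℕ → Ω → Ξ i) (x0 : Vec d) (α : ℝ) (k : ℕ) : ℝ :=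
  (1 / (n : ℝ)) *
    ∑ i, ∫ ω, (avgCost f (atcGTIterate W F ξ x0 α k ω i) - optValue f) ∂P

end

/-! Write `s` for the stacked sampled gradients, `J` for the averaging matrix and `t = 1 - λ`. The
tracker splits as `W g = p + W² s` with `p = W (g - W s)`. This gives `x' = W x - α p - α W² s` and
`p' = W p - W² s + W³ s`. The variable `p` has mean zero and depends only on the iterates up to the
current time, because the recursion for `x` can be solved for `W² s`. The mean therefore performs a
plain stochastic gradient step, and the fresh noise is conditionally centred relative to everything
else in the recursion.

The deviations are diagonalised by an orthonormal eigenbasis of `W - J`, with eigenvalues `l` in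
`[0, λ]`. In a mode, `p` relaxes towards `-l²` times the gradient. The coordinate `b = α / (1 - l) *
(p + l² ∇f(x̄))` measures the distance from that target, and it turns the mode into the triangular
system `X' = l X - (1 - l) b - D - N`, `b' = l b - (D + N) + Y`. Here `D` is the gradient mismatch,
`N` the noise and `Y` the drift of the target. Since `0 ≤ l`, convexity makes `‖X‖² + 2‖b‖²`
contract by `1 - t/2` (`mode_step_le`). The first-order term in `N` vanishes in expectation, so the
noise costs `α² λ⁴ σ²` with no factor `1/t`. The drift `Y` carries `1/t³`, but it only sees the mean
gradient, whose noise variance is `σ²/n` because different agents are uncorrelated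
(`integral_inner_eq_zero_of_condIndep`).

For the mean, smoothness and the PL inequality give contraction by `1 - α μ` up to the consensus
error. A negative multiple of the squared averaged gradient is left over, and it pays for the drift
term of the network. `coupled_recursion_bound` closes the two recursions. Its potential weighs only
the excess of the network error over its stationary noise level, which keeps the network noise at
order `α²`.

Parts (2) and (3) insert `α = 2 ln(K²) / (μ K)`, for which `(1 - αμ/2)^K ≤ 1/K²`. Then `n/t ≤ K` and
`t^(-4/3) ≤ K` are what is needed for the `λ`-dependent noise terms to fall below `σ²/(nK)`. -/

/-- The averaging matrix `(1/n) 𝟙 𝟙ᵀ`. -/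
noncomputable def avgMatrix (n : ℕ) : Matrix (Fin n) (Fin n) ℝ :=
  Matrix.of fun _ _ => (1 / (n : ℝ))

lemma avgMatrix_apply {n : ℕ} (i j : Fin n) : avgMatrix n i j = 1 / (n : ℝ) := rfl

lemma mixingRate_eq {n : ℕ} (W : Matrix (Fin n) (Fin n) ℝ) :
    mixingRate W = (spectralRadius ℝ (W - avgMatrix n)).toReal := rfl

/-! ### Spectrum of the deviation matrix -/

section Network

variable {n : ℕ} {W : Matrix (Fin n) (Fin n) ℝ}

lemma IsCombinationMatrix.row_sum (hW : IsCombinationMatrix W) (i : Fin n) :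
    ∑ j, W i j = 1 :=
  sum_row_of_mem_doublyStochastic hW.stochastic i

lemma IsCombinationMatrix.col_sum (hW : IsCombinationMatrix W) (j : Fin n) :
    ∑ i, W i j = 1 :=
  sum_col_of_mem_doublyStochastic hW.stochastic j

lemma IsCombinationMatrix.mul_avgMatrix (hW : IsCombinationMatrix W) :
    W * avgMatrix n = avgMatrix n := by
  ext i j
  simp [Matrix.mul_apply, avgMatrix_apply, ← Finset.sum_mul, hW.row_sum]

lemma IsCombinationMatrix.avgMatrix_mul (hW : IsCombinationMatrix W) :
    avgMatrix n * W = avgMatrix n := by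
  ext i j
  simp [Matrix.mul_apply, avgMatrix_apply, ← Finset.mul_sum, hW.col_sum]

lemma avgMatrix_mul_self (hn : 1 ≤ n) : avgMatrix n * avgMatrix n = avgMatrix n := by
  have : (n : ℝ) ≠ 0 := by positivity
  ext i j
  simp [Matrix.mul_apply, avgMatrix_apply]
  field_simp

lemma avgMatrix_isHermitian : (avgMatrix n).IsHermitian := by
  ext i j
  simp [avgMatrix_apply]

/-- The deviation matrix is the compression `(1 - J) W (1 - J)` of `W` to the complement of the
constants. -/
lemma IsCombinationMatrix.posSemidef_sub_avgMatrix (hn : 1 ≤ n) (hW : IsCombinationMatrix W)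
    (hp : W.PosSemidef) : (W - avgMatrix n).PosSemidef := by
  have h := hp.conjTranspose_mul_mul_same (1 - avgMatrix n)
  have e : (1 - avgMatrix n).conjTranspose * W * (1 - avgMatrix n) = W - avgMatrix n := by
    rw [Matrix.conjTranspose_sub, Matrix.conjTranspose_one, avgMatrix_isHermitian.eq,
      sub_mul, one_mul, hW.avgMatrix_mul, mul_sub, mul_one, sub_mul, hW.mul_avgMatrix,
      avgMatrix_mul_self hn, sub_self, sub_zero]
  rwa [e] at h

lemma sum_eq_zero_of_eigenvector (hn : 1 ≤ n) (hW : IsCombinationMatrix W) {l : ℝ} (hl : l ≠ 0)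
    {v : Fin n → ℝ} (hv : (W - avgMatrix n).mulVec v = l • v) : ∑ i, v i = 0 := by
  have hn' : (n : ℝ) ≠ 0 := by positivity
  have h : l * ∑ i, v i = 0 := by
    calc l * ∑ i, v i = ∑ i, (W - avgMatrix n).mulVec v i := by
          rw [hv]; simp [Finset.mul_sum]
      _ = ∑ j, (∑ i, (W - avgMatrix n) i j) * v j := by
          simp only [Matrix.mulVec, dotProduct]
          rw [Finset.sum_comm]
          simp only [Finset.sum_mul]
      _ = 0 := by
          refine Finset.sum_eq_zero fun j _ => ?_
          simp [Finset.sum_sub_distrib, hW.col_sum, avgMatrix_apply, hn']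
  exact (mul_eq_zero.mp h).resolve_left hl

/-- A maximum principle for a strictly positive power of `W`. If `1 ≤ l`, the eigenvector has zero
sum, so it is also an eigenvector of `W` and its largest entry is nonnegative. Averaging with
positive weights at that entry then forces all entries to be equal, hence zero. -/
lemma eigenvalue_lt_one (hn : 1 ≤ n) (hW : IsCombinationMatrix W) {l : ℝ}
    {v : Fin n → ℝ} (hv0 : v ≠ 0) (hv : (W - avgMatrix n).mulVec v = l • v) : l < 1 := by
  by_contra! hl
  have hsum := sum_eq_zero_of_eigenvector hn hW (by linarith) hv
  have hWv : W.mulVec v = l • v := by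
    have : (avgMatrix n).mulVec v = 0 := by
      ext i
      simp [Matrix.mulVec, dotProduct, avgMatrix_apply, ← Finset.mul_sum, hsum]
    rwa [Matrix.sub_mulVec, this, sub_zero] at hv
  have hpow : ∀ k, (W ^ k).mulVec v = l ^ k • v := by
    intro k
    induction k with
    | zero => simp
    | succ k ih =>
      rw [pow_succ, ← Matrix.mulVec_mulVec, hWv, Matrix.mulVec_smul, ih, smul_smul, pow_succ,
        mul_comm]
  obtain ⟨k, -, hk⟩ := hW.primitive.exists_pos_pow
  have hne : (Finset.univ : Finset (Fin n)).Nonempty := ⟨⟨0, hn⟩, Finset.mem_univ _⟩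
  obtain ⟨i, -, hi⟩ := Finset.exists_max_image Finset.univ v hne
  have hrow : ∑ j, (W ^ k) i j = 1 :=
    sum_row_of_mem_doublyStochastic (Submonoid.pow_mem _ hW.stochastic k) i
  have hvi : 0 ≤ v i := by
    by_contra! hneg
    have : ∑ j, v j < 0 :=
      Finset.sum_neg (fun j hj => (hi j hj).trans_lt hneg) hne
    linarith
  -- The sum equals `(1 - l ^ k) * v i`, while each of its terms is nonnegative by maximality of `v
  -- i`.
  have hle : ∑ j, (W ^ k) i j * (v i - v j) ≤ 0 := by
    have h1 : ∑ j, (W ^ k) i j * v j = l ^ k * v i := by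
      have := congrFun (hpow k) i
      simpa [Matrix.mulVec, dotProduct] using this
    have h2 : ∑ j, (W ^ k) i j * (v i - v j) = v i - l ^ k * v i := by
      simp only [mul_sub, Finset.sum_sub_distrib, ← Finset.sum_mul, hrow, h1, one_mul]
    rw [h2]
    nlinarith [one_le_pow₀ hl (n := k)]
  have hterm : ∀ j ∈ Finset.univ, 0 ≤ (W ^ k) i j * (v i - v j) := fun j hj =>
    mul_nonneg (hk i j).le (sub_nonneg.mpr (hi j hj))
  have hz := (Finset.sum_eq_zero_iff_of_nonneg hterm).mp (le_antisymm hle (Finset.sum_nonneg hterm))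
  have hconst : ∀ j, v j = v i := fun j => by
    have := (mul_eq_zero.mp (hz j (Finset.mem_univ j))).resolve_left (hk i j).ne'
    linarith
  apply hv0
  have hn' : (n : ℝ) ≠ 0 := by positivity
  have : v i = 0 := by
    simpa [hconst, hn'] using hsum
  ext j
  simp [hconst j, this]

/-- Orthonormal modes of the deviation matrix `W - (1/n) 𝟙 𝟙ᵀ`: the columns of `U`, with
eigenvalues `l`. -/
structure IsModeBasis (W U : Matrix (Fin n) (Fin n) ℝ) (l : Fin n → ℝ) : Prop where
  orthogonal : U * U.transpose = 1
  eigen : ∀ m j, ∑ i, U i m * (W - avgMatrix n) i j = l m * U j m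
  nonneg : ∀ m, 0 ≤ l m
  le_mixingRate : ∀ m, l m ≤ mixingRate W

/-- The spectral theorem for the symmetric deviation matrix. Its spectrum is finite, nonnegative and
below `1`, so the spectral radius is the largest eigenvalue and passing to `toReal` loses nothing.
-/
lemma exists_modeBasis (hn : 1 ≤ n) (hW : IsCombinationMatrix W) (hp : W.PosSemidef) :
    0 ≤ mixingRate W ∧ mixingRate W < 1 ∧ ∃ U l, IsModeBasis W U l := by
  have hpsd := hW.posSemidef_sub_avgMatrix hn hp
  have hH := hpsd.isHermitian
  set A := W - avgMatrix n with hA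
  have hev : ∀ m, A.mulVec (hH.eigenvectorBasis m) = hH.eigenvalues m •
      (hH.eigenvectorBasis m : Fin n → ℝ) := fun m => by
    simpa using hH.mulVec_eigenvectorBasis m
  have hlt : ∀ m, hH.eigenvalues m < 1 := fun m => by
    refine eigenvalue_lt_one hn hW ?_ (hev m)
    intro h0
    have h1 := hH.eigenvectorBasis.orthonormal.ne_zero m
    apply h1
    ext j
    simpa using congrFun h0 j
  have hnn := hpsd.eigenvalues_nonneg
  have hrad : spectralRadius ℝ A = ⨆ m, (‖hH.eigenvalues m‖₊ : ENNReal) := by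
    rw [spectralRadius, hH.spectrum_real_eq_range_eigenvalues, iSup_range]
  have : Nonempty (Fin n) := ⟨⟨0, hn⟩⟩
  have hradlt : spectralRadius ℝ A < 1 := by
    obtain ⟨m, hm⟩ := exists_eq_ciSup_of_finite (f := fun m => (‖hH.eigenvalues m‖₊ : ENNReal))
    rw [hrad, ← hm, ENNReal.coe_lt_one_iff, ← NNReal.coe_lt_coe, coe_nnnorm,
      Real.norm_of_nonneg (hnn m)]
    exact_mod_cast hlt m
  have hle : ∀ m, hH.eigenvalues m ≤ mixingRate W := fun m => by
    have h1 : (‖hH.eigenvalues m‖₊ : ENNReal) ≤ spectralRadius ℝ A := by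
      rw [hrad]; exact le_iSup (fun m => (‖hH.eigenvalues m‖₊ : ENNReal)) m
    have h2 := ENNReal.toReal_mono (hradlt.trans ENNReal.one_lt_top).ne h1
    simpa [Real.norm_of_nonneg (hnn m), mixingRate_eq] using h2
  refine ⟨ENNReal.toReal_nonneg, ?_, (hH.eigenvectorUnitary : Matrix _ _ ℝ), hH.eigenvalues, ?_, ?_, hnn, hle⟩
  · rw [mixingRate_eq]
    exact (ENNReal.toReal_lt_toReal (hradlt.trans ENNReal.one_lt_top).ne ENNReal.one_ne_top).mpr hradlt
  · have := (Matrix.mem_unitaryGroup_iff).mp hH.eigenvectorUnitary.2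
    simpa [Matrix.star_eq_conjTranspose, Matrix.conjTranspose_eq_transpose_of_trivial] using this
  · intro m j
    have h := congrFun (hev m) j
    have hs : ∀ i, A i j = A j i := fun i => by
      simpa using (hH.apply i j).symm
    simp only [Matrix.mulVec, dotProduct, Pi.smul_apply, smul_eq_mul] at h
    simp only [Matrix.IsHermitian.eigenvectorUnitary_apply]
    rw [← h]
    exact Finset.sum_congr rfl fun i _ => by rw [← hA, hs, mul_comm]

end Network

/-! ### Descent lemma and the aggregate cost -/

section Smooth

open scoped RealInnerProductSpace

/-- Along the segment, the difference between `g` and its quadratic upper model has nonpositive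
derivative, by Cauchy–Schwarz and the Lipschitz bound. -/
lemma le_quadratic_of_lipschitz_gradient {E : Type*} [NormedAddCommGroup E]
    [InnerProductSpace ℝ E] [CompleteSpace E] {g : E → ℝ} {L : ℝ} (hg : Differentiable ℝ g)
    (hL : ∀ z y, ‖gradient g z - gradient g y‖ ≤ L * ‖z - y‖) (x y : E) :
    g y ≤ g x + ⟪gradient g x, y - x⟫ + L / 2 * ‖y - x‖ ^ 2 := by
  set v := y - x with hv
  let φ : ℝ → ℝ := fun t => g (x + t • v) - t * ⟪gradient g x, v⟫ - L / 2 * ‖v‖ ^ 2 * t ^ 2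
  have hd : ∀ t, HasDerivAt φ (⟪gradient g (x + t • v), v⟫ - ⟪gradient g x, v⟫
      - L / 2 * ‖v‖ ^ 2 * (2 * t)) t := by
    intro t
    have h1 : HasDerivAt (fun t : ℝ => x + t • v) v t := by
      simpa using ((hasDerivAt_id t).smul_const v).const_add x
    have h2 : HasDerivAt (fun t : ℝ => g (x + t • v)) ⟪gradient g (x + t • v), v⟫ t := by
      have := ((hg (x + t • v)).hasGradientAt.hasFDerivAt).comp_hasDerivAt t h1
      simp only [InnerProductSpace.toDual_apply_apply] at this
      exact this
    have h3 : HasDerivAt (fun t : ℝ => t * ⟪gradient g x, v⟫) ⟪gradient g x, v⟫ t := by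
      simpa using (hasDerivAt_id t).mul_const ⟪gradient g x, v⟫
    have h4 : HasDerivAt (fun t : ℝ => L / 2 * ‖v‖ ^ 2 * t ^ 2) (L / 2 * ‖v‖ ^ 2 * (2 * t)) t := by
      simpa using (hasDerivAt_pow 2 t).const_mul (L / 2 * ‖v‖ ^ 2)
    exact (h2.sub h3).sub h4
  have hanti : AntitoneOn φ (Set.Icc 0 1) := by
    refine antitoneOn_of_deriv_nonpos (convex_Icc 0 1)
      (fun t _ => (hd t).continuousAt.continuousWithinAt)
      (fun t _ => (hd t).differentiableAt.differentiableWithinAt) fun t ht => ?_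
    rw [interior_Icc] at ht
    rw [(hd t).deriv, ← inner_sub_left]
    have h1 := real_inner_le_norm (gradient g (x + t • v) - gradient g x) v
    have h2 : ‖gradient g (x + t • v) - gradient g x‖ ≤ L * (t * ‖v‖) := by
      have := hL (x + t • v) x
      rwa [add_sub_cancel_left, norm_smul, Real.norm_of_nonneg ht.1.le] at this
    nlinarith [mul_le_mul_of_nonneg_right h2 (norm_nonneg v)]
  have := hanti (Set.left_mem_Icc.mpr zero_le_one) (Set.right_mem_Icc.mpr zero_le_one) zero_le_one
  simp only [φ, one_smul, zero_smul, add_zero, hv, add_sub_cancel] at this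
  linarith

variable {n d : ℕ} {f : Fin n → Vec d → ℝ} {L : ℝ}

lemma hasGradientAt_avgCost (hf : ∀ i, Differentiable ℝ (f i)) (x : Vec d) :
    HasGradientAt (avgCost f) ((1 / (n : ℝ)) • ∑ i, gradient (f i) x) x := by
  have h : HasFDerivAt (fun x => (1 / (n : ℝ)) * ∑ i, f i x)
      ((1 / (n : ℝ)) • ∑ i, fderiv ℝ (f i) x) x :=
    (HasFDerivAt.fun_sum fun i _ => (hf i x).hasFDerivAt).const_mul _
  rw [hasGradientAt_iff_hasFDerivAt]
  refine h.congr_fderiv ?_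
  rw [map_smul, map_sum]
  simp only [toDual_gradient]

lemma gradient_avgCost (hf : ∀ i, Differentiable ℝ (f i)) (x : Vec d) :
    gradient (avgCost f) x = (1 / (n : ℝ)) • ∑ i, gradient (f i) x :=
  (hasGradientAt_avgCost hf x).gradient

lemma norm_sq_avg_le {E : Type*} [NormedAddCommGroup E] [NormedSpace ℝ E] (hn : 1 ≤ n)
    (y : Fin n → E) :
    ‖(1 / (n : ℝ)) • ∑ i, y i‖ ^ 2 ≤ (1 / (n : ℝ)) * ∑ i, ‖y i‖ ^ 2 := by
  have hn' : (0 : ℝ) < n := by positivity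
  rw [norm_smul, mul_pow, Real.norm_of_nonneg (by positivity)]
  have h1 : ‖∑ i, y i‖ ^ 2 ≤ n * ∑ i, ‖y i‖ ^ 2 := by
    calc ‖∑ i, y i‖ ^ 2 ≤ (∑ i, ‖y i‖) ^ 2 := by gcongr; exact norm_sum_le _ _
      _ ≤ n * ∑ i, ‖y i‖ ^ 2 := by
        simpa using sq_sum_le_card_mul_sum_sq (s := Finset.univ) (f := fun i => ‖y i‖)
  calc (1 / (n : ℝ)) ^ 2 * ‖∑ i, y i‖ ^ 2 ≤ (1 / (n : ℝ)) ^ 2 * (n * ∑ i, ‖y i‖ ^ 2) := by gcongr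
    _ = _ := by field_simp

namespace IsSmoothObjective

variable (hf : IsSmoothObjective f L)
include hf

lemma differentiable_avgCost : Differentiable ℝ (avgCost f) :=
  fun x => (hasGradientAt_avgCost hf.differentiable x).differentiableAt

lemma lipschitz_avgCost (hn : 1 ≤ n) (z y : Vec d) :
    ‖gradient (avgCost f) z - gradient (avgCost f) y‖ ≤ L * ‖z - y‖ := by
  have hn' : (n : ℝ) ≠ 0 := by positivity
  rw [gradient_avgCost hf.differentiable, gradient_avgCost hf.differentiable, ← smul_sub,
    ← Finset.sum_sub_distrib, norm_smul, Real.norm_of_nonneg (by positivity)]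
  calc (1 / (n : ℝ)) * ‖∑ i, (gradient (f i) z - gradient (f i) y)‖
      ≤ (1 / (n : ℝ)) * ∑ _i : Fin n, L * ‖z - y‖ := by
        gcongr
        exact norm_sum_le_of_le _ fun i _ => hf.lipschitz i z y
    _ = L * ‖z - y‖ := by simp; field_simp

lemma continuous_gradient (i : Fin n) : Continuous (gradient (f i)) :=
  (LipschitzWith.of_dist_le_mul (K := ⟨L, hf.pos.le⟩)
    fun z y => by rw [dist_eq_norm, dist_eq_norm]; exact hf.lipschitz i z y).continuous

lemma avgCost_le (hn : 1 ≤ n) (x y : Vec d) :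
    avgCost f y ≤ avgCost f x + ⟪gradient (avgCost f) x, y - x⟫ + L / 2 * ‖y - x‖ ^ 2 :=
  le_quadratic_of_lipschitz_gradient hf.differentiable_avgCost (hf.lipschitz_avgCost hn) x y

lemma optValue_le (x : Vec d) : optValue f ≤ avgCost f x :=
  ciInf_le hf.bddBelow x

end IsSmoothObjective

end Smooth

/-! ### Orthogonality from conditional independence -/

section CondIndep

open scoped RealInnerProductSpace

variable {Ω : Type*} {m mΩ : MeasurableSpace Ω} {P : Measure Ω}
  {E : Type*} [NormedAddCommGroup E] [InnerProductSpace ℝ E]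

lemma integrable_inner_of_memLp {A w : Ω → E} (hA : MemLp A 2 P) (hw : MemLp w 2 P) :
    Integrable (fun ω => ⟪A ω, w ω⟫) P := by
  refine Integrable.mono' (hA.norm.integrable_mul hw.norm)
    (hA.aestronglyMeasurable.inner hw.aestronglyMeasurable) (Eventually.of_forall fun ω => ?_)
  exact norm_inner_le_norm _ _

variable [CompleteSpace E]

/-- The `m`-measurable factor is pulled out of the conditional expectation. This removes every
first-order noise term below. -/
lemma integral_inner_eq_zero_of_condExp_eq_zero [IsFiniteMeasure P] (hm : m ≤ mΩ) {A w : Ω → E}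
    (hA : MemLp A 2 P) (hAm : StronglyMeasurable[m] A) (hw : MemLp w 2 P)
    (h0 : P[w | m] =ᵐ[P] 0) : ∫ ω, ⟪A ω, w ω⟫ ∂P = 0 := by
  have h := condExp_bilin_of_aestronglyMeasurable_left (μ := P) (m := m) (innerSL ℝ (E := E))
    (f := A) (g := w) hAm.aestronglyMeasurable
    (integrable_inner_of_memLp hA hw) (hw.integrable one_le_two)
  change P[fun ω => ⟪A ω, w ω⟫ | m] =ᵐ[P] fun ω => ⟪A ω, (P[w | m]) ω⟫ at h
  rw [← integral_condExp hm, integral_congr_ae h]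
  refine integral_eq_zero_of_ae ?_
  filter_upwards [h0] with ω hω
  simp [hω]

/-- The conditional expectation is determined by its set integrals over a generating π-system. -/
lemma condExp_ae_eq_of_piSystem [IsFiniteMeasure P] {F : Type*} [NormedAddCommGroup F]
    [NormedSpace ℝ F] [CompleteSpace F] (hm : m ≤ mΩ) {C : Set (Set Ω)}
    (hC : m = MeasurableSpace.generateFrom C) (hpi : IsPiSystem C) {g h : Ω → F}
    (hg : Integrable g P) (hh : Integrable h P) (hhm : StronglyMeasurable[m] h)
    (huniv : ∫ ω, g ω ∂P = ∫ ω, h ω ∂P)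
    (hset : ∀ s ∈ C, ∫ ω in s, g ω ∂P = ∫ ω in s, h ω ∂P) : P[g | m] =ᵐ[P] h := by
  have key : ∀ s, MeasurableSet[m] s → ∫ ω in s, g ω ∂P = ∫ ω in s, h ω ∂P := by
    intro s hs
    induction s, hs using MeasurableSpace.induction_on_inter hC hpi with
    | empty => simp
    | basic t ht => exact hset t ht
    | compl t ht ih =>
      rw [setIntegral_compl (hm _ ht) hg, setIntegral_compl (hm _ ht) hh, huniv, ih]
    | iUnion t hd ht ih =>
      rw [integral_iUnion (fun i => hm _ (ht i)) hd hg.integrableOn,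
        integral_iUnion (fun i => hm _ (ht i)) hd hh.integrableOn]
      exact tsum_congr ih
  exact (ae_eq_condExp_of_forall_setIntegral_eq hm hg (fun s _ _ => hh.integrableOn)
    (fun s hs _ => (key s hs).symm) hhm.aestronglyMeasurable).symm

/-- Intersections of an `m`-measurable set and a set pulled back along `X`. -/
def supComapSets {S : Type*} [MeasurableSpace S] (m : MeasurableSpace Ω) (X : Ω → S) :
    Set (Set Ω) :=
  {s | ∃ B A, MeasurableSet[m] B ∧ MeasurableSet A ∧ s = B ∩ X ⁻¹' A}

lemma isPiSystem_supComapSets {S : Type*} [MeasurableSpace S] (X : Ω → S) :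
    IsPiSystem (supComapSets m X) := by
  rintro _ ⟨B, A, hB, hA, rfl⟩ _ ⟨B', A', hB', hA', rfl⟩ -
  refine ⟨B ∩ B', A ∩ A', hB.inter hB', hA.inter hA', ?_⟩
  rw [Set.preimage_inter, Set.inter_inter_inter_comm]

lemma generateFrom_supComapSets {S : Type*} [mS : MeasurableSpace S] (X : Ω → S) :
    m ⊔ mS.comap X = MeasurableSpace.generateFrom (supComapSets m X) := by
  refine le_antisymm (sup_le ?_ ?_) (MeasurableSpace.generateFrom_le ?_)
  · intro B hB
    exact MeasurableSpace.measurableSet_generateFrom ⟨B, Set.univ, hB, MeasurableSet.univ, by simp⟩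
  · rintro _ ⟨A, hA, rfl⟩
    exact MeasurableSpace.measurableSet_generateFrom ⟨Set.univ, A, MeasurableSet.univ, hA, by simp⟩
  · rintro _ ⟨B, A, hB, hA, rfl⟩
    exact MeasurableSet.inter ((le_sup_left : m ≤ m ⊔ mS.comap X) _ hB)
      ((le_sup_right : mS.comap X ≤ m ⊔ mS.comap X) _ ⟨A, hA, rfl⟩)

lemma integrable_indicator_one [IsFiniteMeasure P] {s : Set Ω} (hs : MeasurableSet s) :
    Integrable (s.indicator fun _ => (1 : ℝ)) P :=
  (integrable_const 1).indicator hs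

lemma integral_smul_condProb [IsFiniteMeasure P] {F : Type*} [NormedAddCommGroup F]
    [NormedSpace ℝ F] [CompleteSpace F] (hm : m ≤ mΩ) {s : Set Ω} (hs : MeasurableSet s)
    {g : Ω → F} (hg : Integrable g P) :
    ∫ ω, (P⟦s | m⟧) ω • g ω ∂P = ∫ ω, (P⟦s | m⟧) ω • (P[g | m]) ω ∂P := by
  have hb : ∀ᵐ ω ∂P, ‖(P⟦s | m⟧) ω‖ ≤ 1 := by
    have h0 : 0 ≤ᵐ[P] P⟦s | m⟧ := condExp_nonneg (Eventually.of_forall fun ω =>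
      Set.indicator_nonneg (fun _ _ => zero_le_one) ω)
    have h1 : P⟦s | m⟧ ≤ᵐ[P] P[fun _ => (1 : ℝ) | m] :=
      condExp_mono (integrable_indicator_one hs) (integrable_const _)
        (Eventually.of_forall fun ω => Set.indicator_le_self' (fun _ _ => zero_le_one) ω)
    rw [condExp_const hm] at h1
    filter_upwards [h0, h1] with ω hω0 hω1
    rw [Real.norm_of_nonneg hω0]
    exact hω1
  have hi : Integrable (fun ω => (P⟦s | m⟧) ω • g ω) P :=
    hg.bdd_smul 1 (stronglyMeasurable_condExp.mono hm).aestronglyMeasurable hb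
  have h := condExp_smul_of_aestronglyMeasurable_left (m := m) (μ := P) (f := P⟦s | m⟧) (g := g)
    stronglyMeasurable_condExp.aestronglyMeasurable hi hg
  rw [← integral_condExp hm]
  exact integral_congr_ae h

/-- Self-adjointness of conditional expectation: both sides are the integral of `P⟦s | m⟧ * P⟦t |
m⟧`. -/
lemma setIntegral_condProb_comm [IsFiniteMeasure P] (hm : m ≤ mΩ) {s t : Set Ω}
    (hs : MeasurableSet s) (ht : MeasurableSet t) :
    ∫ ω in t, (P⟦s | m⟧) ω ∂P = ∫ ω in s, (P⟦t | m⟧) ω ∂P := by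
  have e : ∀ {a b : Set Ω}, MeasurableSet b → ∫ ω in b, (P⟦a | m⟧) ω ∂P =
      ∫ ω, (P⟦a | m⟧) ω • b.indicator (fun _ => (1 : ℝ)) ω ∂P := by
    intro a b hb
    rw [← integral_indicator hb]
    congr 1
    ext ω
    by_cases h : ω ∈ b <;> simp [h]
  rw [e ht, e hs, integral_smul_condProb hm hs (integrable_indicator_one ht),
    integral_smul_condProb hm ht (integrable_indicator_one hs)]
  simp only [smul_eq_mul, mul_comm]

lemma setIntegral_indicator_one_comm {s t : Set Ω} (hs : MeasurableSet s) (ht : MeasurableSet t) :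
    ∫ ω in t, s.indicator (fun _ => (1 : ℝ)) ω ∂P =
      ∫ ω in s, t.indicator (fun _ => (1 : ℝ)) ω ∂P := by
  rw [setIntegral_indicator hs, setIntegral_indicator ht, Set.inter_comm]

variable {S T : Type*} [mS : MeasurableSpace S] [mT : MeasurableSpace T] {X : Ω → S} {Y : Ω → T}

/-- Product conditional independence says that learning `Y` does not change the conditional law of
`X`. It suffices to test this on the generating sets `C ∩ Y ⁻¹' B`, where it is the assumed
factorisation. -/
lemma condProb_preimage_sup_comap [IsFiniteMeasure P] (hm : m ≤ mΩ) (hX : Measurable X)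
    (hY : Measurable Y)
    (h : ∀ A B, MeasurableSet A → MeasurableSet B →
      P⟦X ⁻¹' A ∩ Y ⁻¹' B | m⟧ =ᵐ[P] P⟦X ⁻¹' A | m⟧ * P⟦Y ⁻¹' B | m⟧)
    {A : Set S} (hA : MeasurableSet A) :
    P⟦X ⁻¹' A | m ⊔ mT.comap Y⟧ =ᵐ[P] P⟦X ⁻¹' A | m⟧ := by
  have hsup : m ⊔ mT.comap Y ≤ mΩ := sup_le hm hY.comap_le
  refine condExp_ae_eq_of_piSystem hsup (generateFrom_supComapSets Y) (isPiSystem_supComapSets Y)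
    (integrable_indicator_one (hX hA)) integrable_condExp
    (stronglyMeasurable_condExp.mono le_sup_left) (integral_condExp hm).symm ?_
  rintro _ ⟨C, B, hC, hB, rfl⟩
  have hAB : MeasurableSet (X ⁻¹' A ∩ Y ⁻¹' B) := (hX hA).inter (hY hB)
  rw [← setIntegral_indicator (hY hB), Set.indicator_indicator, Set.inter_comm (Y ⁻¹' B),
    ← setIntegral_condExp hm (integrable_indicator_one hAB) hC,
    setIntegral_congr_ae (hm _ hC) ((h A B hA hB).mono fun ω hω _ => hω)]
  have h2 : (fun ω => (Y ⁻¹' B).indicator (P⟦X ⁻¹' A | m⟧) ω) =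
      P⟦X ⁻¹' A | m⟧ * (Y ⁻¹' B).indicator fun _ => (1 : ℝ) := by
    ext ω
    by_cases hω : ω ∈ Y ⁻¹' B <;> simp [hω]
  have hi : Integrable (P⟦X ⁻¹' A | m⟧ * (Y ⁻¹' B).indicator fun _ => (1 : ℝ)) P := by
    rw [← h2]
    exact integrable_condExp.indicator (hY hB)
  have h3 := condExp_mul_of_stronglyMeasurable_left (m := m) (μ := P) stronglyMeasurable_condExp hi
    (integrable_indicator_one (hY hB))
  rw [← setIntegral_indicator (hY hB), h2, ← setIntegral_condExp hm hi hC]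
  exact setIntegral_congr_ae (hm _ hC) (h3.mono fun ω hω _ => hω.symm)

/-- Extends the factorisation from preimages under `Y` to every event of `m ⊔ mT.comap Y`. On a test
set `C ∩ X ⁻¹' A` the two indicators are exchanged, the conditional probability of the test set is
reduced to `m` by the previous lemma, and self-adjointness moves the conditioning back onto `t`. -/
lemma condProb_sup_comap [IsFiniteMeasure P] (hm : m ≤ mΩ) (hX : Measurable X)
    (hY : Measurable Y)
    (h : ∀ A B, MeasurableSet A → MeasurableSet B →
      P⟦X ⁻¹' A ∩ Y ⁻¹' B | m⟧ =ᵐ[P] P⟦X ⁻¹' A | m⟧ * P⟦Y ⁻¹' B | m⟧)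
    {t : Set Ω} (ht : MeasurableSet[m ⊔ mT.comap Y] t) :
    P⟦t | m ⊔ mS.comap X⟧ =ᵐ[P] P⟦t | m⟧ := by
  have hsupX : m ⊔ mS.comap X ≤ mΩ := sup_le hm hX.comap_le
  have hsupY : m ⊔ mT.comap Y ≤ mΩ := sup_le hm hY.comap_le
  refine condExp_ae_eq_of_piSystem hsupX (generateFrom_supComapSets X) (isPiSystem_supComapSets X)
    (integrable_indicator_one (hsupY _ ht)) integrable_condExp
    (stronglyMeasurable_condExp.mono le_sup_left) (integral_condExp hm).symm ?_
  rintro _ ⟨C, A, hC, hA, rfl⟩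
  have hCA : MeasurableSet (C ∩ X ⁻¹' A) := (hm _ hC).inter (hX hA)
  have hcond : P⟦C ∩ X ⁻¹' A | m ⊔ mT.comap Y⟧ =ᵐ[P] P⟦C ∩ X ⁻¹' A | m⟧ := by
    have e : (C ∩ X ⁻¹' A).indicator (fun _ => (1 : ℝ)) =
        C.indicator ((X ⁻¹' A).indicator fun _ => (1 : ℝ)) := by
      rw [Set.indicator_indicator]
    rw [e]
    have h1 := condExp_indicator (m := m ⊔ mT.comap Y) (integrable_indicator_one (P := P) (hX hA))
      ((le_sup_left : m ≤ m ⊔ mT.comap Y) _ hC)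
    have h2 := condExp_indicator (m := m) (integrable_indicator_one (P := P) (hX hA)) hC
    filter_upwards [h1, h2, condProb_preimage_sup_comap hm hX hY h hA] with ω hω1 hω2 hω3
    rw [hω1, hω2]
    by_cases hω : ω ∈ C <;> simp [hω, hω3]
  rw [setIntegral_indicator_one_comm (hsupY _ ht) hCA, ← setIntegral_condProb_comm hm hCA (hsupY _ ht),
    ← setIntegral_condExp hsupY (integrable_indicator_one hCA) ht]
  exact setIntegral_congr_ae (hsupY _ ht) (hcond.mono fun ω hω _ => hω)

/-- If `X` and `Y` are conditionally independent given `m`, a function of `m` and `X` is orthogonal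
to every function of `m` and `Y` that has vanishing conditional expectation given `m`. -/
theorem integral_inner_eq_zero_of_condIndep [IsFiniteMeasure P] (hm : m ≤ mΩ) (hX : Measurable X)
    (hY : Measurable Y)
    (h : ∀ A B, MeasurableSet A → MeasurableSet B →
      P⟦X ⁻¹' A ∩ Y ⁻¹' B | m⟧ =ᵐ[P] P⟦X ⁻¹' A | m⟧ * P⟦Y ⁻¹' B | m⟧)
    {φ ψ : Ω → E} (hφ : MemLp φ 2 P) (hφm : StronglyMeasurable[m ⊔ mS.comap X] φ)
    (hψ : MemLp ψ 2 P) (hψm : StronglyMeasurable[m ⊔ mT.comap Y] ψ) (hψ0 : P[ψ | m] =ᵐ[P] 0) :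
    ∫ ω, ⟪φ ω, ψ ω⟫ ∂P = 0 := by
  have hsupX : m ⊔ mS.comap X ≤ mΩ := sup_le hm hX.comap_le
  have hsupY : m ⊔ mT.comap Y ≤ mΩ := sup_le hm hY.comap_le
  have h' : ∀ A B, MeasurableSet A → MeasurableSet B →
      P⟦Y ⁻¹' A ∩ X ⁻¹' B | m⟧ =ᵐ[P] P⟦Y ⁻¹' A | m⟧ * P⟦X ⁻¹' B | m⟧ := fun A B hA hB => by
    rw [Set.inter_comm, mul_comm]
    exact h B A hB hA
  have hψi := hψ.integrable one_le_two
  refine integral_inner_eq_zero_of_condExp_eq_zero hsupX hφ hφm hψ ?_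
  -- It remains to see that `ψ` has zero integral over every event `s` of `m` and `X`. Conditioning
  -- `1_s` on `m` and `Y` replaces it by `P⟦s | m⟧`, and then `ψ` can be replaced by its vanishing
  -- conditional expectation given `m`.
  refine (ae_eq_condExp_of_forall_setIntegral_eq hsupX hψi (g := 0)
    (fun s _ _ => integrableOn_zero) (fun s hs _ => ?_) aestronglyMeasurable_zero).symm
  have e : ∫ ω in s, ψ ω ∂P = ∫ ω, s.indicator (fun _ => (1 : ℝ)) ω • ψ ω ∂P := by
    rw [← integral_indicator (hsupX _ hs)]
    congr 1
    ext ω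
    by_cases hω : ω ∈ s <;> simp [hω]
  have hi : Integrable (fun ω => s.indicator (fun _ => (1 : ℝ)) ω • ψ ω) P := by
    refine (hψi.indicator (hsupX _ hs)).congr (Eventually.of_forall fun ω => ?_)
    by_cases hω : ω ∈ s <;> simp [hω]
  have h1 := condExp_smul_of_aestronglyMeasurable_right (m := m ⊔ mT.comap Y) (μ := P)
    (integrable_indicator_one (hsupX _ hs)) hi hψm.aestronglyMeasurable
  have h2 := condProb_sup_comap hm hY hX h' hs
  have h3 : ∫ ω, s.indicator (fun _ => (1 : ℝ)) ω • ψ ω ∂P = ∫ ω, (P⟦s | m⟧) ω • ψ ω ∂P := by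
    rw [← integral_condExp hsupY]
    refine integral_congr_ae ?_
    filter_upwards [h1, h2] with ω hω1 hω2
    rw [← hω2]
    exact hω1
  rw [e, h3, integral_smul_condProb hm (hsupX _ hs) hψi]
  simp only [Pi.zero_apply, integral_zero]
  refine (integral_eq_zero_of_ae ?_).symm
  filter_upwards [hψ0] with ω hω
  simp [hω]

end CondIndep

/-! ### Contraction in a single mode -/

section ModeStep

open scoped RealInnerProductSpace

variable {E : Type*} [NormedAddCommGroup E] [InnerProductSpace ℝ E]

lemma norm_add_sq_le_young {η : ℝ} (hη : 0 < η) (a b : E) :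
    ‖a + b‖ ^ 2 ≤ (1 + η) * ‖a‖ ^ 2 + (1 + 1 / η) * ‖b‖ ^ 2 := by
  have h1 := norm_add_sq_real a b
  have h2 := real_inner_le_norm a b
  have h3 : 2 * (‖a‖ * ‖b‖) ≤ η * ‖a‖ ^ 2 + 1 / η * ‖b‖ ^ 2 := by
    have : 0 ≤ (η * ‖a‖ - ‖b‖) ^ 2 / η := by positivity
    have e : (η * ‖a‖ - ‖b‖) ^ 2 / η = η * ‖a‖ ^ 2 + 1 / η * ‖b‖ ^ 2 - 2 * (‖a‖ * ‖b‖) := by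
      field_simp
      ring
    linarith
  linarith

/-- The gap between the two sides is exactly `l (1 - l) ‖a + b‖²`, which is nonnegative only because
`l` lies in `[0, 1]`; this is where positive semidefiniteness of `W` enters. -/
lemma norm_convex_sub_sq_le {l : ℝ} (h0 : 0 ≤ l) (h1 : l ≤ 1) (a b : E) :
    ‖l • a - (1 - l) • b‖ ^ 2 ≤ l * ‖a‖ ^ 2 + (1 - l) * ‖b‖ ^ 2 := by
  have e : l * ‖a‖ ^ 2 + (1 - l) * ‖b‖ ^ 2 - ‖l • a - (1 - l) • b‖ ^ 2
      = l * (1 - l) * ‖a + b‖ ^ 2 := by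
    rw [norm_sub_sq_real, norm_add_sq_real, norm_smul, norm_smul, real_inner_smul_left,
      real_inner_smul_right, Real.norm_of_nonneg h0, Real.norm_of_nonneg (sub_nonneg.mpr h1)]
    ring
  have := mul_nonneg (mul_nonneg h0 (sub_nonneg.mpr h1)) (sq_nonneg ‖a + b‖)
  linarith

/-- One step of the consensus and tracking errors in an eigenmode of eigenvalue `l`, with
perturbation `D`, noise `N` and input `Y`. -/
lemma mode_step_le {l t : ℝ} (hl : 0 ≤ l) (ht : 0 < t) (hlt : l ≤ 1 - t) (X b D N Y : E) :
    ‖l • X - (1 - l) • b - (D + N)‖ ^ 2 + 2 * ‖l • b - (D + N) + Y‖ ^ 2 ≤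
      (1 - 3 * t / 20) * (‖X‖ ^ 2 + 2 * ‖b‖ ^ 2) + 17 / t * ‖D‖ ^ 2 + 5 * ‖N‖ ^ 2 +
        24 / t * ‖Y‖ ^ 2 - 2 * ⟪l • X - (1 - l) • b - D + (2 : ℝ) • (l • b - D), N⟫ := by
  have ht1 : t ≤ 1 := by linarith
  set H := l • X - (1 - l) • b with hH
  have hconv := norm_convex_sub_sq_le hl (by linarith : l ≤ 1) X b
  rw [← hH] at hconv
  have hb : ‖l • b‖ ^ 2 = l ^ 2 * ‖b‖ ^ 2 := by rw [norm_smul, mul_pow, Real.norm_eq_abs, sq_abs]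
  -- contraction of the homogeneous part
  have hhom : ‖H‖ ^ 2 + 2 * ‖l • b‖ ^ 2 ≤ (1 - t / 2) * (‖X‖ ^ 2 + 2 * ‖b‖ ^ 2) := by
    rw [hb]
    have := mul_nonneg (by linarith : 0 ≤ 1 - t / 2 - l) (sq_nonneg ‖X‖)
    -- With `t ≤ 1 - l` the bracket is at least `2 l (1 - l)`. The weight `2` on `b` leaves room for
    -- the `1 - l` that leaks from `b` into `X`.
    have h2 : 0 ≤ (2 - t - (1 - l) - 2 * l ^ 2) * ‖b‖ ^ 2 :=
      mul_nonneg (by nlinarith) (sq_nonneg _)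
    nlinarith
  -- The Young parameters `t/4` here and `t/10` for `Y` are paid for by the margin `t/2`: to first
  -- order `-1/2 + 1/4 + 1/10 = -3/20`, and the higher-order terms are negative.
  have hη : 0 < t / 4 := by positivity
  have y1 := norm_add_sq_le_young hη H (-D)
  have y2 := norm_add_sq_le_young hη (l • b) (-D)
  rw [← sub_eq_add_neg, norm_neg] at y1 y2
  have hA : ‖H - D‖ ^ 2 + 2 * ‖l • b - D‖ ^ 2 ≤
      (1 + t / 4) * (1 - t / 2) * (‖X‖ ^ 2 + 2 * ‖b‖ ^ 2) + (1 + 4 / t) * (3 * ‖D‖ ^ 2) := by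
    have h3 : (1 + 1 / (t / 4)) = 1 + 4 / t := by field_simp
    rw [h3] at y1 y2
    have := mul_le_mul_of_nonneg_left hhom (by positivity : 0 ≤ 1 + t / 4)
    linarith
  have e1 : ‖H - (D + N)‖ ^ 2 = ‖H - D‖ ^ 2 - 2 * ⟪H - D, N⟫ + ‖N‖ ^ 2 := by
    rw [← sub_sub, norm_sub_sq_real]
  -- The drift `Y` may depend on the noise, so its product with `N` is estimated. Only the product
  -- of `N` with the predictable `l • b - D` is kept exactly, to be integrated away later.
  have e2 : ‖l • b - (D + N) + Y‖ ^ 2 ≤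
      (1 + t / 10) * ‖l • b - D‖ ^ 2 - 2 * ⟪l • b - D, N⟫ + 2 * ‖N‖ ^ 2 +
        (2 + 10 / t) * ‖Y‖ ^ 2 := by
    have h1 : l • b - (D + N) + Y = (l • b - D) + (Y - N) := by abel
    have h2 := real_inner_le_norm (l • b - D) Y
    have h3 : 2 * (‖l • b - D‖ * ‖Y‖) ≤ t / 10 * ‖l • b - D‖ ^ 2 + 10 / t * ‖Y‖ ^ 2 := by
      have : 0 ≤ (t / 10 * ‖l • b - D‖ - ‖Y‖) ^ 2 * (10 / t) := by positivity
      have e : (t / 10 * ‖l • b - D‖ - ‖Y‖) ^ 2 * (10 / t) =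
          t / 10 * ‖l • b - D‖ ^ 2 + 10 / t * ‖Y‖ ^ 2 - 2 * (‖l • b - D‖ * ‖Y‖) := by
        field_simp
        ring
      linarith
    have h4 : ‖Y - N‖ ^ 2 ≤ 2 * ‖Y‖ ^ 2 + 2 * ‖N‖ ^ 2 := by
      have := parallelogram_law_with_norm ℝ Y N
      linarith [mul_self_nonneg ‖Y + N‖, sq ‖Y - N‖, sq ‖Y‖, sq ‖N‖]
    rw [h1, norm_add_sq_real, inner_sub_right]
    linarith
  have e3 : ⟪H - D + (2 : ℝ) • (l • b - D), N⟫ = ⟪H - D, N⟫ + 2 * ⟪l • b - D, N⟫ := by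
    rw [inner_add_left, real_inner_smul_left]
  have hV : 0 ≤ ‖X‖ ^ 2 + 2 * ‖b‖ ^ 2 := by positivity
  have f1 : (1 + t / 10) * (‖H - D‖ ^ 2 + 2 * ‖l • b - D‖ ^ 2) ≤
      (1 - 3 * t / 20) * (‖X‖ ^ 2 + 2 * ‖b‖ ^ 2) + 17 / t * ‖D‖ ^ 2 := by
    have g1 := mul_le_mul_of_nonneg_left hA (by positivity : 0 ≤ 1 + t / 10)
    have g2 : (1 + t / 10) * ((1 + t / 4) * (1 - t / 2)) ≤ 1 - 3 * t / 20 := by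
      nlinarith [sq_nonneg t, mul_pos ht ht, mul_pos (mul_pos ht ht) ht]
    have g3 : (1 + t / 10) * ((1 + 4 / t) * 3) ≤ 17 / t := by
      rw [show (1 + 4 / t) * 3 = (t + 4) * 3 / t by field_simp, ← mul_div_assoc]
      gcongr
      nlinarith
    calc _ ≤ _ := g1
      _ = (1 + t / 10) * ((1 + t / 4) * (1 - t / 2)) * (‖X‖ ^ 2 + 2 * ‖b‖ ^ 2) +
          (1 + t / 10) * ((1 + 4 / t) * 3) * ‖D‖ ^ 2 := by ring
      _ ≤ _ := by gcongr
  have f2 : (4 + 2 * (10 / t)) * ‖Y‖ ^ 2 ≤ 24 / t * ‖Y‖ ^ 2 := by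
    gcongr
    rw [show 24 / t = 4 / t + 2 * (10 / t) by ring]
    gcongr
    rw [le_div_iff₀ ht]
    linarith
  rw [e1, e3]
  linarith [mul_nonneg ht.le (sq_nonneg ‖H - D‖)]

end ModeStep

/-! ### Matrices acting on stacked vectors -/

section Mix

open scoped RealInnerProductSpace

variable {n d : ℕ}

/-- The action `y ↦ (i ↦ ∑ j, Mᵢⱼ yⱼ)` of a matrix on stacked vectors. -/
noncomputable def mix (d : ℕ) (M : Matrix (Fin n) (Fin n) ℝ) :
    (Fin n → Vec d) →ₗ[ℝ] (Fin n → Vec d) where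
  toFun y i := ∑ j, M i j • y j
  map_add' y z := by ext1 i; simp [Finset.sum_add_distrib]
  map_smul' c y := by
    ext1 i
    simp only [Pi.smul_apply, RingHom.id_apply, Finset.smul_sum]
    exact Finset.sum_congr rfl fun j _ => smul_comm _ _ _

lemma mix_apply (M : Matrix (Fin n) (Fin n) ℝ) (y : Fin n → Vec d) (i : Fin n) :
    mix d M y i = ∑ j, M i j • y j := rfl

lemma mix_mul (M N : Matrix (Fin n) (Fin n) ℝ) (y : Fin n → Vec d) :
    mix d (M * N) y = mix d M (mix d N y) := by
  ext1 i
  simp only [mix_apply, Matrix.mul_apply, Finset.sum_smul, Finset.smul_sum, smul_smul]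
  exact Finset.sum_comm

lemma mix_sub_left (M N : Matrix (Fin n) (Fin n) ℝ) (y : Fin n → Vec d) :
    mix d (M - N) y = mix d M y - mix d N y := by
  ext1 i
  simp [mix_apply, sub_smul, Finset.sum_sub_distrib]

/-- The mean of a stacked vector. -/
noncomputable def mean (y : Fin n → Vec d) : Vec d := (1 / (n : ℝ)) • ∑ i, y i

lemma mix_avgMatrix (y : Fin n → Vec d) (i : Fin n) : mix d (avgMatrix n) y i = mean y := by
  simp [mix_apply, mean, avgMatrix_apply, Finset.smul_sum]

/-- Parseval's identity for the orthogonal change to mode coordinates. -/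
lemma sum_norm_sq_mix_transpose {U : Matrix (Fin n) (Fin n) ℝ} (hU : U * U.transpose = 1)
    (y : Fin n → Vec d) : ∑ m, ‖mix d U.transpose y m‖ ^ 2 = ∑ i, ‖y i‖ ^ 2 := by
  have h : ∀ m, ‖mix d U.transpose y m‖ ^ 2 = ∑ i, ∑ j, (U i m * U j m) * ⟪y i, y j⟫ := by
    intro m
    rw [← real_inner_self_eq_norm_sq, mix_apply, sum_inner]
    refine Finset.sum_congr rfl fun i _ => ?_
    rw [inner_sum]
    refine Finset.sum_congr rfl fun j _ => ?_
    rw [real_inner_smul_left, real_inner_smul_right]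
    simp only [Matrix.transpose_apply]
    ring
  simp only [h]
  rw [Finset.sum_comm]
  refine Finset.sum_congr rfl fun i _ => ?_
  rw [Finset.sum_comm]
  have h2 : ∀ j, ∑ m, (U i m * U j m) * ⟪y i, y j⟫ = if i = j then ⟪y i, y j⟫ else 0 := by
    intro j
    have := congrFun (congrFun hU i) j
    simp only [Matrix.mul_apply, Matrix.transpose_apply, Matrix.one_apply] at this
    rw [← Finset.sum_mul, this]
    split_ifs <;> simp
  simp only [h2]
  simp

variable {W U : Matrix (Fin n) (Fin n) ℝ} {l : Fin n → ℝ}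

lemma IsModeBasis.mix_deviation (hU : IsModeBasis W U l) (y : Fin n → Vec d) (m : Fin n) :
    mix d U.transpose (mix d (W - avgMatrix n) y) m = l m • mix d U.transpose y m := by
  rw [← mix_mul, mix_apply, mix_apply, Finset.smul_sum]
  refine Finset.sum_congr rfl fun j _ => ?_
  rw [smul_smul, Matrix.mul_apply]
  simp only [Matrix.transpose_apply]
  rw [hU.eigen m j]

end Mix

/-! ### One step of the network energy -/

section NetworkStep

open scoped RealInnerProductSpace

variable {n d : ℕ}

/-- The stacked gradient `i ↦ ∇fᵢ(xᵢ)`. -/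
noncomputable def gradStack (f : Fin n → Vec d → ℝ) (x : Fin n → Vec d) : Fin n → Vec d :=
  fun i => gradient (f i) (x i)

/-- The stacked gradient at the mean of `x`. -/
noncomputable def gradMean (f : Fin n → Vec d → ℝ) (x : Fin n → Vec d) : Fin n → Vec d :=
  gradStack f fun _ => mean x

/-- The deviations `xᵢ - x̄`. -/
noncomputable def deviation (x : Fin n → Vec d) : Fin n → Vec d := fun i => x i - mean x

/-- Mode coordinates of the consensus error. -/
noncomputable def consensusMode (U : Matrix (Fin n) (Fin n) ℝ) (x : Fin n → Vec d) :
    Fin n → Vec d :=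
  mix d U.transpose (deviation x)

/-- Mode coordinates of the tracking error. -/
noncomputable def trackingMode (U : Matrix (Fin n) (Fin n) ℝ) (l : Fin n → ℝ) (α : ℝ)
    (f : Fin n → Vec d → ℝ) (x p : Fin n → Vec d) (m : Fin n) : Vec d :=
  (α / (1 - l m)) •
    (mix d U.transpose p m + l m ^ 2 • mix d U.transpose (gradMean f x) m)

/-- The quadratic functional of consensus and tracking errors. -/
noncomputable def networkEnergy (U : Matrix (Fin n) (Fin n) ℝ) (l : Fin n → ℝ) (α : ℝ)
    (f : Fin n → Vec d → ℝ) (x p : Fin n → Vec d) : ℝ :=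
  ∑ m, (‖consensusMode U x m‖ ^ 2 + 2 * ‖trackingMode U l α f x p m‖ ^ 2)

/-- The vector against which the noise in mode `m` enters the network energy to first order. -/
noncomputable def noiseWeight (U : Matrix (Fin n) (Fin n) ℝ) (l : Fin n → ℝ) (α : ℝ)
    (f : Fin n → Vec d → ℝ) (x p : Fin n → Vec d) (m : Fin n) : Vec d :=
  let D := (α * l m ^ 2) • mix d U.transpose (gradStack f x - gradMean f x) m
  l m • consensusMode U x m - (1 - l m) • trackingMode U l α f x p m - D +
    (2 : ℝ) • (l m • trackingMode U l α f x p m - D)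

variable {W U : Matrix (Fin n) (Fin n) ℝ} {l : Fin n → ℝ} {f : Fin n → Vec d → ℝ} {α L : ℝ}

lemma deviation_eq (x : Fin n → Vec d) : deviation x = x - mix d (avgMatrix n) x := by
  ext1 i
  simp [deviation, mix_avgMatrix]

lemma mean_sub (x y : Fin n → Vec d) : mean (x - y) = mean x - mean y := by
  simp [mean, smul_sub]

lemma mean_add (x y : Fin n → Vec d) : mean (x + y) = mean x + mean y := by
  simp [mean, smul_add, Finset.sum_add_distrib]

lemma mean_smul (c : ℝ) (x : Fin n → Vec d) : mean (c • x) = c • mean x := by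
  simp [mean, ← Finset.smul_sum, smul_comm c]

lemma mean_const (hn : 1 ≤ n) (y : Vec d) : mean (fun _ : Fin n => y) = y := by
  have : (n : ℝ) ≠ 0 := by positivity
  simp only [mean, Finset.sum_const, Finset.card_univ, Fintype.card_fin, ← Nat.cast_smul_eq_nsmul ℝ,
    smul_smul]
  rw [one_div_mul_cancel this, one_smul]

lemma sum_deviation (hn : 1 ≤ n) (x : Fin n → Vec d) : ∑ i, deviation x i = 0 := by
  have : (n : ℝ) ≠ 0 := by positivity
  simp only [deviation, Finset.sum_sub_distrib, Finset.sum_const, Finset.card_univ,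
    Fintype.card_fin, ← Nat.cast_smul_eq_nsmul ℝ, mean, smul_smul]
  rw [mul_one_div_cancel this, one_smul, sub_self]

lemma sum_norm_sq_consensusMode (hU : IsModeBasis W U l) (x : Fin n → Vec d) :
    ∑ m, ‖consensusMode U x m‖ ^ 2 = ∑ i, ‖deviation x i‖ ^ 2 :=
  sum_norm_sq_mix_transpose hU.orthogonal _

lemma networkEnergy_nonneg (x p : Fin n → Vec d) : 0 ≤ networkEnergy U l α f x p :=
  Finset.sum_nonneg fun _ _ => by positivity

lemma sum_norm_sq_deviation_le_networkEnergy (hU : IsModeBasis W U l) (x p : Fin n → Vec d) :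
    ∑ i, ‖deviation x i‖ ^ 2 ≤ networkEnergy U l α f x p := by
  rw [← sum_norm_sq_consensusMode hU]
  exact Finset.sum_le_sum fun m _ => le_add_of_nonneg_right (by positivity)

lemma IsCombinationMatrix.mean_mix (hW : IsCombinationMatrix W) (x : Fin n → Vec d) :
    mean (mix d W x) = mean x := by
  simp only [mean, mix_apply]
  rw [Finset.sum_comm]
  simp [← Finset.sum_smul, hW.col_sum]

lemma IsCombinationMatrix.mean_mix_pow (hW : IsCombinationMatrix W) (k : ℕ) (x : Fin n → Vec d) :
    mean (mix d (W ^ k) x) = mean x := by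
  induction k with
  | zero => simp [mean, mix_apply, Matrix.one_apply]
  | succ k ih => rw [pow_succ', mix_mul, hW.mean_mix, ih]

lemma IsModeBasis.mix_deviation_pow (hU : IsModeBasis W U l) (k : ℕ) (y : Fin n → Vec d) (m : Fin n) :
    mix d U.transpose (mix d ((W - avgMatrix n) ^ k) y) m =
      l m ^ k • mix d U.transpose y m := by
  induction k generalizing y with
  | zero =>
    have : mix d (1 : Matrix (Fin n) (Fin n) ℝ) y = y := by
      ext1 i; simp [mix_apply, Matrix.one_apply]
    simp [this]
  | succ k ih => rw [pow_succ', mix_mul, hU.mix_deviation, ih, smul_smul, pow_succ']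

section

variable (hn : 1 ≤ n) (hW : IsCombinationMatrix W) (hU : IsModeBasis W U l)
include hn hW

lemma IsCombinationMatrix.mix_deviation (x : Fin n → Vec d) :
    mix d (W - avgMatrix n) (deviation x) = mix d W x - mix d (avgMatrix n) x := by
  rw [deviation_eq, map_sub, ← mix_mul, sub_mul, hW.mul_avgMatrix, avgMatrix_mul_self hn, sub_self,
    mix_sub_left]
  ext1 i
  simp [mix_apply]

/-- `J` is idempotent and absorbs `W` on both sides. The exponent starts at `1`, since the zeroth
powers differ by `J`. -/
lemma IsCombinationMatrix.sub_avgMatrix_pow (k : ℕ) :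
    (W - avgMatrix n) ^ (k + 1) = W ^ (k + 1) - avgMatrix n := by
  have hpow : ∀ k, W ^ k * avgMatrix n = avgMatrix n := fun k => by
    induction k with
    | zero => simp
    | succ k ih => rw [pow_succ, mul_assoc, hW.mul_avgMatrix, ih]
  induction k with
  | zero => simp
  | succ k ih =>
    rw [pow_succ, ih, sub_mul, mul_sub, mul_sub, hpow, ← pow_succ, hW.avgMatrix_mul,
      avgMatrix_mul_self hn, sub_self, sub_zero]

include hU

lemma consensusMode_step {x p s x' : Fin n → Vec d}
    (hx' : x' = mix d W x - α • p - α • mix d (W ^ 2) s) (hp : mean p = 0) (m : Fin n) :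
    consensusMode U x' m = l m • consensusMode U x m -
      α • mix d U.transpose p m - (α * l m ^ 2) • mix d U.transpose s m := by
  have e : deviation x' = mix d ((W - avgMatrix n)) (deviation x) - α • p -
      α • mix d ((W - avgMatrix n) ^ 2) s := by
    rw [hW.mix_deviation hn, hW.sub_avgMatrix_pow hn 1, mix_sub_left]
    ext1 i
    simp only [deviation, hx', mean_sub, mean_smul, hW.mean_mix, hW.mean_mix_pow, hp,
      Pi.sub_apply, Pi.smul_apply, mix_avgMatrix, smul_zero, one_add_one_eq_two]
    module
  rw [consensusMode, e, map_sub, map_sub, map_smul, map_smul, Pi.sub_apply, Pi.sub_apply,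
    Pi.smul_apply, Pi.smul_apply, hU.mix_deviation, hU.mix_deviation_pow, consensusMode]
  module

/-- In a mode the coefficient of `s` is `l³ - l²`, so `-l² ŝ` is the fixed point of the tracker for
a constant input with mode coordinate `ŝ`. This dictates the shift by `l²` in `trackingMode`. -/
lemma tracker_step {p s p' : Fin n → Vec d}
    (hp' : p' = mix d W p - mix d (W ^ 2) s + mix d (W ^ 3) s) (hp : mean p = 0) (m : Fin n) :
    mix d U.transpose p' m = l m • mix d U.transpose p m -
      (l m ^ 2 * (1 - l m)) • mix d U.transpose s m := by
  have e : p' = mix d ((W - avgMatrix n)) p - mix d ((W - avgMatrix n) ^ 2) s +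
      mix d ((W - avgMatrix n) ^ 3) s := by
    rw [hW.sub_avgMatrix_pow hn 1, hW.sub_avgMatrix_pow hn 2, mix_sub_left, mix_sub_left,
      mix_sub_left]
    ext1 i
    simp only [hp', Pi.sub_apply, Pi.add_apply, mix_avgMatrix, hp, one_add_one_eq_two,
      two_add_one_eq_three]
    module
  rw [e, map_add, map_sub, Pi.add_apply, Pi.sub_apply, hU.mix_deviation,
    hU.mix_deviation_pow, hU.mix_deviation_pow]
  module

/-- Summing `mode_step_le` over the modes by Parseval. The mismatch between gradients at `x` and at
the mean is `L`-Lipschitz in the consensus error, so the step-size condition absorbs it into the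
contraction. -/
lemma networkEnergy_step_le (hf : IsSmoothObjective f L) (hlam : mixingRate W < 1) (hα : 0 ≤ α)
    (hstep : α ^ 2 * L ^ 2 * mixingRate W ^ 4 ≤ (1 - mixingRate W) ^ 2 / 648)
    {x p w s x' p' : Fin n → Vec d} (hs : s = gradStack f x + w)
    (hx' : x' = mix d W x - α • p - α • mix d (W ^ 2) s)
    (hp' : p' = mix d W p - mix d (W ^ 2) s + mix d (W ^ 3) s) (hp : mean p = 0) :
    networkEnergy U l α f x' p' ≤
      (1 - (1 - mixingRate W) / 9) * networkEnergy U l α f x p +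
        5 * (α ^ 2 * mixingRate W ^ 4) * ∑ i, ‖w i‖ ^ 2 +
        24 * (α ^ 4 * L ^ 2 * mixingRate W ^ 4) / (1 - mixingRate W) ^ 3 * (n * ‖mean s‖ ^ 2) -
        2 * ∑ m, (α * l m ^ 2) * ⟪noiseWeight U l α f x p m, mix d U.transpose w m⟫ := by
  set lam := mixingRate W with hlamdef
  set t := 1 - lam with ht
  have ht0 : 0 < t := by linarith
  set T := mix d U.transpose with hT
  set δ := gradStack f x - gradMean f x with hδ
  set Δ := gradMean f x' - gradMean f x with hΔ
  have hl1 : ∀ m, 0 < 1 - l m := fun m => by linarith [hU.le_mixingRate m]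
  have hs' : ∀ m, T s m = T (gradMean f x) m + T δ m + T w m := fun m => by
    rw [hs, hδ, map_add, map_sub]
    simp
  have hX : ∀ m, consensusMode U x' m = l m • consensusMode U x m -
      (1 - l m) • trackingMode U l α f x p m - ((α * l m ^ 2) • T δ m + (α * l m ^ 2) • T w m) := by
    intro m
    rw [consensusMode_step hn hW hU hx' hp, ← hT, hs', trackingMode, ← hT, smul_smul,
      mul_div_cancel₀ _ (hl1 m).ne']
    module
  -- The division by `1 - l m` in `trackingMode` cancels the factor `1 - l m` multiplying the noise
  -- in the tracker recursion. Only the drift of the target keeps that denominator.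
  have hb : ∀ m, trackingMode U l α f x' p' m = l m • trackingMode U l α f x p m -
      ((α * l m ^ 2) • T δ m + (α * l m ^ 2) • T w m) +
      (α * l m ^ 2 / (1 - l m)) • T Δ m := by
    intro m
    have e : T Δ m = T (gradMean f x') m - T (gradMean f x) m := by rw [hΔ, map_sub]; rfl
    rw [trackingMode, tracker_step hn hW hU hp' hp, ← hT, hs', trackingMode, ← hT, e]
    have := (hl1 m).ne'
    match_scalars <;> field_simp <;> ring
  have hmode : ∀ m, ‖consensusMode U x' m‖ ^ 2 + 2 * ‖trackingMode U l α f x' p' m‖ ^ 2 ≤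
      (1 - 3 * t / 20) * (‖consensusMode U x m‖ ^ 2 + 2 * ‖trackingMode U l α f x p m‖ ^ 2) +
      17 / t * (α ^ 2 * lam ^ 4) * ‖T δ m‖ ^ 2 + 5 * (α ^ 2 * lam ^ 4) * ‖T w m‖ ^ 2 +
      24 / t * (α ^ 2 * lam ^ 4 / t ^ 2) * ‖T Δ m‖ ^ 2 -
      2 * ((α * l m ^ 2) * ⟪noiseWeight U l α f x p m, T w m⟫) := by
    intro m
    have h := mode_step_le (hU.nonneg m) ht0 (by linarith [hU.le_mixingRate m] : l m ≤ 1 - t)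
      (consensusMode U x m) (trackingMode U l α f x p m) ((α * l m ^ 2) • T δ m)
      ((α * l m ^ 2) • T w m) ((α * l m ^ 2 / (1 - l m)) • T Δ m)
    rw [← hX, ← hb, inner_smul_right] at h
    have hc : (α * l m ^ 2) ^ 2 ≤ α ^ 2 * lam ^ 4 := by
      have := pow_le_pow_left₀ (hU.nonneg m) (hU.le_mixingRate m) 4
      calc (α * l m ^ 2) ^ 2 = α ^ 2 * l m ^ 4 := by ring
        _ ≤ _ := by gcongr
    have hc' : (α * l m ^ 2 / (1 - l m)) ^ 2 ≤ α ^ 2 * lam ^ 4 / t ^ 2 := by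
      rw [div_pow]
      have : t ≤ 1 - l m := by linarith [hU.le_mixingRate m]
      gcongr
    have hsq : ∀ (c : ℝ) (y : Vec d), ‖c • y‖ ^ 2 = c ^ 2 * ‖y‖ ^ 2 := fun c y => by
      rw [norm_smul, mul_pow, Real.norm_eq_abs, sq_abs]
    rw [hsq, hsq, hsq] at h
    have h1 : 17 / t * ((α * l m ^ 2) ^ 2 * ‖T δ m‖ ^ 2) ≤
        17 / t * (α ^ 2 * lam ^ 4) * ‖T δ m‖ ^ 2 := by
      rw [mul_assoc]; gcongr
    have h2 : 5 * ((α * l m ^ 2) ^ 2 * ‖T w m‖ ^ 2) ≤ 5 * (α ^ 2 * lam ^ 4) * ‖T w m‖ ^ 2 := by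
      rw [mul_assoc]; gcongr
    have h3 : 24 / t * ((α * l m ^ 2 / (1 - l m)) ^ 2 * ‖T Δ m‖ ^ 2) ≤
        24 / t * (α ^ 2 * lam ^ 4 / t ^ 2) * ‖T Δ m‖ ^ 2 := by
      rw [mul_assoc]; gcongr
    have h4 : ⟪noiseWeight U l α f x p m, T w m⟫ = ⟪l m • consensusMode U x m -
      (1 - l m) • trackingMode U l α f x p m - (α * l m ^ 2) • T δ m +
      (2 : ℝ) • (l m • trackingMode U l α f x p m - (α * l m ^ 2) • T δ m), T w m⟫ := rfl
    rw [h4]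
    linarith
  have hδsum : ∑ m, ‖T δ m‖ ^ 2 ≤ L ^ 2 * networkEnergy U l α f x p := by
    rw [hT, sum_norm_sq_mix_transpose hU.orthogonal]
    refine le_trans ?_ (mul_le_mul_of_nonneg_left
      (sum_norm_sq_deviation_le_networkEnergy hU x p) (sq_nonneg L))
    rw [Finset.mul_sum]
    refine Finset.sum_le_sum fun i _ => ?_
    rw [← mul_pow]
    exact pow_le_pow_left₀ (norm_nonneg _) (hf.lipschitz i _ _) 2
  -- The target is evaluated at the mean, which moves by `-α • mean s`. The drift thus meets only
  -- averaged noise, which is the source of the factor `1/n` in the term of order `1/t⁴`.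
  have hΔsum : ∑ m, ‖T Δ m‖ ^ 2 ≤ n * (L ^ 2 * (α ^ 2 * ‖mean s‖ ^ 2)) := by
    have hm : mean x' - mean x = -(α • mean s) := by
      rw [hx', mean_sub, mean_sub, mean_smul, mean_smul, hW.mean_mix, hW.mean_mix_pow, hp]
      module
    rw [hT, sum_norm_sq_mix_transpose hU.orthogonal]
    refine (Finset.sum_le_card_nsmul _ _ (L ^ 2 * (α ^ 2 * ‖mean s‖ ^ 2)) fun i _ => ?_).trans
      (by simp)
    have h := hf.lipschitz i (mean x') (mean x)
    rw [hm, norm_neg, norm_smul, Real.norm_of_nonneg hα] at h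
    rw [← mul_pow, ← mul_pow]
    exact pow_le_pow_left₀ (norm_nonneg _) h 2
  have hwsum : ∑ m, ‖T w m‖ ^ 2 = ∑ i, ‖w i‖ ^ 2 := sum_norm_sq_mix_transpose hU.orthogonal w
  have hV := networkEnergy_nonneg (U := U) (l := l) (α := α) (f := f) x p
  have htot := Finset.sum_le_sum fun m (_ : m ∈ Finset.univ) => hmode m
  simp only [Finset.sum_sub_distrib, Finset.sum_add_distrib, ← Finset.mul_sum] at htot
  have hE : ∀ x p, ∑ m, ‖consensusMode U x m‖ ^ 2 + 2 * ∑ m, ‖trackingMode U l α f x p m‖ ^ 2 =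
      networkEnergy U l α f x p := fun x p => by
    rw [networkEnergy, Finset.sum_add_distrib, ← Finset.mul_sum]
  rw [hE, hE, hwsum] at htot
  -- The mismatch spends `17/648` of the rate `3/20`; more than `1/9` remains.
  have k1 : 17 / t * (α ^ 2 * lam ^ 4) * ∑ m, ‖T δ m‖ ^ 2 ≤
      17 / 648 * t * networkEnergy U l α f x p := by
    calc 17 / t * (α ^ 2 * lam ^ 4) * ∑ m, ‖T δ m‖ ^ 2
        ≤ 17 / t * (α ^ 2 * lam ^ 4) * (L ^ 2 * networkEnergy U l α f x p) := by gcongr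
      _ = 17 / t * (α ^ 2 * L ^ 2 * lam ^ 4) * networkEnergy U l α f x p := by ring
      _ ≤ 17 / t * (t ^ 2 / 648) * networkEnergy U l α f x p := by gcongr
      _ = _ := by field_simp
  have k2 : 24 / t * (α ^ 2 * lam ^ 4 / t ^ 2) * ∑ m, ‖T Δ m‖ ^ 2 ≤
      24 * (α ^ 4 * L ^ 2 * lam ^ 4) / t ^ 3 * (n * ‖mean s‖ ^ 2) := by
    calc 24 / t * (α ^ 2 * lam ^ 4 / t ^ 2) * ∑ m, ‖T Δ m‖ ^ 2
        ≤ 24 / t * (α ^ 2 * lam ^ 4 / t ^ 2) * (n * (L ^ 2 * (α ^ 2 * ‖mean s‖ ^ 2))) := by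
          gcongr
      _ = _ := by field_simp
  have k3 : 0 ≤ t * networkEnergy U l α f x p := mul_nonneg ht0.le hV
  linarith

end

/-- All agents start at one point and `p = 0`, so only the tracking coordinates survive. Their
factor `l²` is the action of `(W - J)²` on the initial gradients, whose squared norm is `n ζ₀²`. -/
lemma networkEnergy_zero_le (hn : 1 ≤ n) (hW : IsCombinationMatrix W) (hU : IsModeBasis W U l)
    (hf : IsSmoothObjective f L) (hlam : mixingRate W < 1) (x0 : Vec d) :
    networkEnergy U l α f (fun _ => x0) 0 ≤
      2 * (α ^ 2 / (1 - mixingRate W) ^ 2 * (n * zetaSq W f x0)) := by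
  have hn' : (n : ℝ) ≠ 0 := by positivity
  have ht0 : 0 < 1 - mixingRate W := by linarith
  have hc : ∀ m, consensusMode U (fun _ => x0) m = 0 := fun m => by
    have : deviation (fun _ : Fin n => x0) = 0 := by
      ext1 i
      simp [deviation, mean_const hn]
    rw [consensusMode, this, map_zero]
    rfl
  set y := gradStack f fun _ => x0 with hy
  have hb : ∀ m, ‖trackingMode U l α f (fun _ => x0) 0 m‖ ^ 2 ≤ α ^ 2 / (1 - mixingRate W) ^ 2 *
      ‖mix d U.transpose (mix d ((W - avgMatrix n) ^ 2) y) m‖ ^ 2 := by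
    intro m
    have h1 : 1 - mixingRate W ≤ 1 - l m := by linarith [hU.le_mixingRate m]
    rw [trackingMode, gradMean, mean_const hn, hU.mix_deviation_pow, map_zero, Pi.zero_apply,
      zero_add, norm_smul, mul_pow, Real.norm_eq_abs, sq_abs, div_pow]
    gcongr
  have hz : ∑ i, ‖mix d ((W - avgMatrix n) ^ 2) y i‖ ^ 2 = n * zetaSq W f x0 := by
    rw [zetaSq, ← mul_assoc, mul_one_div_cancel hn', one_mul]
    refine Finset.sum_congr rfl fun i _ => ?_
    rw [hW.sub_avgMatrix_pow hn 1, mix_sub_left, Pi.sub_apply, mix_avgMatrix,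
      gradient_avgCost hf.differentiable]
    rfl
  rw [networkEnergy]
  simp only [hc, norm_zero]
  rw [← hz, ← sum_norm_sq_mix_transpose hU.orthogonal, Finset.mul_sum, Finset.mul_sum]
  refine Finset.sum_le_sum fun m _ => ?_
  have := hb m
  linarith

end NetworkStep

/-! ### Recursions in expectation -/

section TrackingDynamics

open scoped RealInnerProductSpace

variable {n d : ℕ} {Ω : Type*} [mΩ : MeasurableSpace Ω] {P : Measure Ω}
  {W U : Matrix (Fin n) (Fin n) ℝ} {l : Fin n → ℝ} {f : Fin n → Vec d → ℝ} {α L μ σ : ℝ}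
  {x0 : Vec d}

/-- The joint evolution of the iterates `x`, a predictable tracking variable `p` and the sampled
gradients `s`, whose noise `s - ∇f(x)` is conditionally centred given `𝓕` and uncorrelated between
different agents. -/
structure IsTrackingDynamics (P : Measure Ω) (W : Matrix (Fin n) (Fin n) ℝ)
    (f : Fin n → Vec d → ℝ) (α σ : ℝ) (x0 : Vec d) (𝓕 : ℕ → MeasurableSpace Ω)
    (x p s : ℕ → Ω → Fin n → Vec d) : Prop where
  le : ∀ k, 𝓕 k ≤ mΩ
  x_zero : ∀ ω, x 0 ω = fun _ => x0
  p_zero : ∀ ω, p 0 ω = 0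
  x_succ : ∀ k ω, x (k + 1) ω = mix d W (x k ω) - α • p k ω - α • mix d (W ^ 2) (s k ω)
  p_succ : ∀ k ω, p (k + 1) ω =
    mix d W (p k ω) - mix d (W ^ 2) (s k ω) + mix d (W ^ 3) (s k ω)
  measurable_x : ∀ k, Measurable[𝓕 k] (x k)
  measurable_p : ∀ k, Measurable[𝓕 k] (p k)
  memLp_noise : ∀ k i, MemLp (fun ω => s k ω i - gradStack f (x k ω) i) 2 P
  unbiased : ∀ k i, P[fun ω => s k ω i - gradStack f (x k ω) i | 𝓕 k] =ᵐ[P] 0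
  variance : ∀ k i, ∫ ω, ‖s k ω i - gradStack f (x k ω) i‖ ^ 2 ∂P ≤ σ ^ 2
  uncorrelated : ∀ k i j, i ≠ j →
    ∫ ω, ⟪s k ω i - gradStack f (x k ω) i, s k ω j - gradStack f (x k ω) j⟫ ∂P = 0

lemma memLp_fun_const_smul {y : Ω → Vec d} (hy : MemLp y 2 P) (c : ℝ) :
    MemLp (fun ω => c • y ω) 2 P :=
  hy.const_smul c

lemma memLp_mix {y : Ω → Fin n → Vec d} (hy : ∀ i, MemLp (fun ω => y ω i) 2 P)
    (M : Matrix (Fin n) (Fin n) ℝ) (m : Fin n) : MemLp (fun ω => mix d M (y ω) m) 2 P := by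
  simp only [mix_apply]
  exact memLp_finsetSum _ fun i _ => memLp_fun_const_smul (hy i) _

lemma memLp_mean {y : Ω → Fin n → Vec d} (hy : ∀ i, MemLp (fun ω => y ω i) 2 P) :
    MemLp (fun ω => mean (y ω)) 2 P :=
  memLp_fun_const_smul (memLp_finsetSum _ fun i _ => hy i) _

lemma IsSmoothObjective.memLp_gradStack [IsFiniteMeasure P] (hf : IsSmoothObjective f L)
    {y : Ω → Fin n → Vec d}
    (hy : ∀ i, MemLp (fun ω => y ω i) 2 P) (i : Fin n) :
    MemLp (fun ω => gradStack f (y ω) i) 2 P := by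
  have hc : MemLp (fun _ : Ω => ‖gradient (f i) 0‖) 2 P := memLp_const _
  have hy' : MemLp (fun ω => L * ‖y ω i‖) 2 P := (hy i).norm.const_mul L
  have hb : MemLp (fun ω => ‖gradient (f i) 0‖ + L * ‖y ω i‖) 2 P := hc.add hy'
  have hm : AEStronglyMeasurable (fun ω => gradStack f (y ω) i) P :=
    (hf.continuous_gradient i).comp_aestronglyMeasurable (hy i).1
  refine hb.mono' hm (Eventually.of_forall fun ω => ?_)
  have h1 := hf.lipschitz i (y ω i) 0
  have h2 := norm_le_norm_add_norm_sub' (gradient (f i) (y ω i)) (gradient (f i) 0)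
  rw [sub_zero] at h1
  exact h2.trans (by gcongr)

/-- The cost lies between its infimum and a quadratic function. -/
lemma IsSmoothObjective.integrable_avgCost [IsFiniteMeasure P] (hn : 1 ≤ n)
    (hf : IsSmoothObjective f L) {y : Ω → Vec d} (hy : MemLp y 2 P) :
    Integrable (fun ω => avgCost f (y ω)) P := by
  have hb : Integrable (fun ω => |optValue f| + (|avgCost f 0| +
      ‖gradient (avgCost f) 0‖ * ‖y ω‖ + L / 2 * ‖y ω‖ ^ 2)) P :=
    (integrable_const _).add (((integrable_const _).add
      ((hy.norm.integrable one_le_two).const_mul _)).add (hy.integrable_norm_pow two_ne_zero |>.const_mul _))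
  refine hb.mono' (hf.differentiable_avgCost.continuous.comp_aestronglyMeasurable hy.1)
    (Eventually.of_forall fun ω => ?_)
  have h1 := hf.avgCost_le hn 0 (y ω)
  have h2 := hf.optValue_le (y ω)
  have h3 := real_inner_le_norm (gradient (avgCost f) 0) (y ω)
  rw [sub_zero] at h1
  have h4 : 0 ≤ L / 2 * ‖y ω‖ ^ 2 := mul_nonneg (by linarith [hf.pos]) (sq_nonneg _)
  have h5 : 0 ≤ ‖gradient (avgCost f) 0‖ * ‖y ω‖ := by positivity
  rw [Real.norm_eq_abs, abs_le]
  constructor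
  · linarith [neg_abs_le (optValue f), abs_nonneg (avgCost f 0)]
  · linarith [le_abs_self (avgCost f 0), abs_nonneg (optValue f)]

lemma integrable_norm_sq {E : Type*} [NormedAddCommGroup E] {y : Ω → E} (hy : MemLp y 2 P) :
    Integrable (fun ω => ‖y ω‖ ^ 2) P :=
  hy.integrable_norm_pow two_ne_zero

namespace IsTrackingDynamics

variable {𝓕 : ℕ → MeasurableSpace Ω} {x p s : ℕ → Ω → Fin n → Vec d}
  [IsProbabilityMeasure P] (hT : IsTrackingDynamics P W f α σ x0 𝓕 x p s)
include hT

omit [IsProbabilityMeasure P] in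
lemma mean_p (hW : IsCombinationMatrix W) (k : ℕ) (ω : Ω) : mean (p k ω) = 0 := by
  induction k with
  | zero => simp [hT.p_zero, mean]
  | succ k ih =>
    rw [hT.p_succ, mean_add, mean_sub, hW.mean_mix, hW.mean_mix_pow, hW.mean_mix_pow, ih]
    abel

lemma memLp_s_of_memLp_x (hf : IsSmoothObjective f L) {k : ℕ}
    (hx : ∀ i, MemLp (fun ω => x k ω i) 2 P) (i : Fin n) : MemLp (fun ω => s k ω i) 2 P := by
  have := (hT.memLp_noise k i).add (hf.memLp_gradStack hx i)
  refine this.congr_norm ?_ (Eventually.of_forall fun ω => ?_)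
  · refine this.1.congr (Eventually.of_forall fun ω => ?_)
    simp
  · simp

lemma memLp_x_p (hf : IsSmoothObjective f L) (k : ℕ) :
    (∀ i, MemLp (fun ω => x k ω i) 2 P) ∧ ∀ i, MemLp (fun ω => p k ω i) 2 P := by
  induction k with
  | zero =>
    simp only [hT.x_zero, hT.p_zero]
    exact ⟨fun _ => memLp_const _, fun _ => memLp_const _⟩
  | succ k ih =>
    have hs := hT.memLp_s_of_memLp_x hf ih.1
    simp only [hT.x_succ, hT.p_succ]
    exact ⟨fun i => ((memLp_mix ih.1 _ i).sub ((ih.2 i).const_smul α)).sub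
        ((memLp_mix hs _ i).const_smul α),
      fun i => ((memLp_mix ih.2 _ i).sub (memLp_mix hs _ i)).add (memLp_mix hs _ i)⟩

lemma memLp_x (hf : IsSmoothObjective f L) (k : ℕ) (i : Fin n) :
    MemLp (fun ω => x k ω i) 2 P :=
  (hT.memLp_x_p hf k).1 i

lemma memLp_p (hf : IsSmoothObjective f L) (k : ℕ) (i : Fin n) :
    MemLp (fun ω => p k ω i) 2 P :=
  (hT.memLp_x_p hf k).2 i

lemma memLp_s (hf : IsSmoothObjective f L) (k : ℕ) (i : Fin n) :
    MemLp (fun ω => s k ω i) 2 P :=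
  hT.memLp_s_of_memLp_x hf (hT.memLp_x hf k) i

lemma memLp_gradMean (hf : IsSmoothObjective f L) (k : ℕ) (i : Fin n) :
    MemLp (fun ω => gradMean f (x k ω) i) 2 P :=
  hf.memLp_gradStack (y := fun ω _ => mean (x k ω)) (fun _ => memLp_mean (hT.memLp_x hf k)) i

lemma memLp_consensusMode (hf : IsSmoothObjective f L) (k : ℕ) (m : Fin n) :
    MemLp (fun ω => consensusMode U (x k ω) m) 2 P :=
  memLp_mix (fun i => (hT.memLp_x hf k i).sub (memLp_mean (hT.memLp_x hf k))) _ m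

lemma memLp_trackingMode (hf : IsSmoothObjective f L) (k : ℕ) (m : Fin n) :
    MemLp (fun ω => trackingMode U l α f (x k ω) (p k ω) m) 2 P :=
  memLp_fun_const_smul ((memLp_mix (hT.memLp_p hf k) _ m).add
    (memLp_fun_const_smul (memLp_mix (hT.memLp_gradMean hf k) _ m) _)) _

lemma memLp_noiseWeight (hf : IsSmoothObjective f L) (k : ℕ) (m : Fin n) :
    MemLp (fun ω => noiseWeight U l α f (x k ω) (p k ω) m) 2 P := by
  have hD : MemLp (fun ω => (α * l m ^ 2) • mix d U.transpose
      (gradStack f (x k ω) - gradMean f (x k ω)) m) 2 P :=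
    memLp_fun_const_smul (memLp_mix (y := fun ω => gradStack f (x k ω) - gradMean f (x k ω))
      (fun i => (hf.memLp_gradStack (hT.memLp_x hf k) i).sub (hT.memLp_gradMean hf k i)) _ m) _
  have hX := hT.memLp_consensusMode (U := U) hf k m
  have hb := hT.memLp_trackingMode (U := U) (l := l) hf k m
  have h1 := ((memLp_fun_const_smul hX (l m)).sub (memLp_fun_const_smul hb (1 - l m))).sub hD
  have h2 := memLp_fun_const_smul ((memLp_fun_const_smul hb (l m)).sub hD) 2
  exact h1.add h2

lemma integrable_networkEnergy (hf : IsSmoothObjective f L) (k : ℕ) :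
    Integrable (fun ω => networkEnergy U l α f (x k ω) (p k ω)) P :=
  integrable_finsetSum _ fun m _ => (integrable_norm_sq (hT.memLp_consensusMode hf k m)).add
    ((integrable_norm_sq (hT.memLp_trackingMode hf k m)).const_mul 2)

omit [IsProbabilityMeasure P] in
/-- Continuous functions of the iterates and the tracking variable are predictable. -/
lemma stronglyMeasurable_comp (k : ℕ) {φ : (Fin n → Vec d) × (Fin n → Vec d) → Vec d}
    (hφ : Continuous φ) : StronglyMeasurable[𝓕 k] fun ω => φ (x k ω, p k ω) := by
  have : Measurable[𝓕 k] fun ω => (x k ω, p k ω) :=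
    (hT.measurable_x k).prodMk (hT.measurable_p k)
  exact (hφ.measurable.comp this).stronglyMeasurable

lemma integral_inner_noise (k : ℕ) (i : Fin n) {A : Ω → Vec d}
    (hA : MemLp A 2 P) (hAm : StronglyMeasurable[𝓕 k] A) :
    ∫ ω, ⟪A ω, s k ω i - gradStack f (x k ω) i⟫ ∂P = 0 :=
  integral_inner_eq_zero_of_condExp_eq_zero (hT.le k) hA hAm (hT.memLp_noise k i)
    (hT.unbiased k i)

lemma integral_inner_sum_noise (k : ℕ) (c : Fin n → ℝ) {A : Ω → Vec d}
    (hA : MemLp A 2 P) (hAm : StronglyMeasurable[𝓕 k] A) :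
    ∫ ω, ⟪A ω, ∑ i, c i • (s k ω i - gradStack f (x k ω) i)⟫ ∂P = 0 := by
  simp only [inner_sum, real_inner_smul_right]
  rw [integral_finsetSum _ fun i _ =>
    (integrable_inner_of_memLp hA (hT.memLp_noise k i)).const_mul _]
  refine Finset.sum_eq_zero fun i _ => ?_
  rw [integral_const_mul, hT.integral_inner_noise k i hA hAm, mul_zero]

omit [IsProbabilityMeasure P] in
-- Expanding the square, the off-diagonal terms vanish because the agents are uncorrelated. This is
-- the source of the linear speedup.
lemma integral_norm_sq_mean_noise_le (hn : 1 ≤ n) (k : ℕ) :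
    ∫ ω, ‖mean (s k ω - gradStack f (x k ω))‖ ^ 2 ∂P ≤ σ ^ 2 / n := by
  have hn' : (n : ℝ) ≠ 0 := by positivity
  have e : ∀ ω, ‖mean (s k ω - gradStack f (x k ω))‖ ^ 2 = (1 / (n : ℝ)) ^ 2 * ∑ i, ∑ j,
      ⟪s k ω i - gradStack f (x k ω) i, s k ω j - gradStack f (x k ω) j⟫ := by
    intro ω
    rw [mean, norm_smul, mul_pow, Real.norm_eq_abs, sq_abs, ← real_inner_self_eq_norm_sq, sum_inner]
    simp only [inner_sum, Pi.sub_apply]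
  simp only [e]
  have hi : ∀ i j, Integrable (fun ω =>
      ⟪s k ω i - gradStack f (x k ω) i, s k ω j - gradStack f (x k ω) j⟫) P :=
    fun i j => integrable_inner_of_memLp (hT.memLp_noise k i) (hT.memLp_noise k j)
  rw [integral_const_mul, integral_finsetSum _ fun i _ => integrable_finsetSum _ fun j _ => hi i j]
  have h1 : ∀ i, ∫ ω, ∑ j, ⟪s k ω i - gradStack f (x k ω) i,
      s k ω j - gradStack f (x k ω) j⟫ ∂P ≤ σ ^ 2 := by
    intro i
    rw [integral_finsetSum _ fun j _ => hi i j, Finset.sum_eq_single i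
      (fun j _ hj => hT.uncorrelated k i j hj.symm) (fun h => absurd (Finset.mem_univ i) h)]
    simp only [real_inner_self_eq_norm_sq]
    exact hT.variance k i
  calc (1 / (n : ℝ)) ^ 2 * ∑ i, ∫ ω, ∑ j, ⟪s k ω i - gradStack f (x k ω) i,
        s k ω j - gradStack f (x k ω) j⟫ ∂P
      ≤ (1 / (n : ℝ)) ^ 2 * ∑ _i : Fin n, σ ^ 2 := by
        gcongr with i
        exact h1 i
    _ = σ ^ 2 / n := by
      simp
      field_simp

lemma integral_norm_sq_mean_s_le (hn : 1 ≤ n) (hf : IsSmoothObjective f L) (k : ℕ) :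
    ∫ ω, ‖mean (s k ω)‖ ^ 2 ∂P ≤ ∫ ω, ‖mean (gradStack f (x k ω))‖ ^ 2 ∂P + σ ^ 2 / n := by
  have hg := memLp_mean (hf.memLp_gradStack (hT.memLp_x hf k))
  have hw : MemLp (fun ω => mean (s k ω - gradStack f (x k ω))) 2 P :=
    memLp_mean fun i => hT.memLp_noise k i
  have e : ∀ ω, ‖mean (s k ω)‖ ^ 2 = ‖mean (gradStack f (x k ω))‖ ^ 2 +
      2 * ⟪mean (gradStack f (x k ω)), mean (s k ω - gradStack f (x k ω))⟫ +
      ‖mean (s k ω - gradStack f (x k ω))‖ ^ 2 := by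
    intro ω
    rw [← norm_add_sq_real, ← mean_add, add_sub_cancel]
  have hcross : ∫ ω, ⟪mean (gradStack f (x k ω)), mean (s k ω - gradStack f (x k ω))⟫ ∂P = 0 := by
    have := hT.integral_inner_sum_noise k (fun _ => 1 / (n : ℝ)) hg
      (hT.stronglyMeasurable_comp k (φ := fun q => mean (gradStack f q.1)) (by
        have := hf.continuous_gradient
        unfold mean gradStack
        fun_prop))
    simpa only [mean, Finset.smul_sum, Pi.sub_apply] using this
  have hI : Integrable (fun ω => ‖mean (gradStack f (x k ω))‖ ^ 2 +
      2 * ⟪mean (gradStack f (x k ω)), mean (s k ω - gradStack f (x k ω))⟫) P :=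
    (integrable_norm_sq hg).add ((integrable_inner_of_memLp hg hw).const_mul 2)
  simp only [e]
  rw [integral_add hI (integrable_norm_sq hw), integral_add (integrable_norm_sq hg)
    ((integrable_inner_of_memLp hg hw).const_mul 2), integral_const_mul, hcross]
  linarith [hT.integral_norm_sq_mean_noise_le hn k]

/-- The recursion for the expected network energy. -/
lemma integral_networkEnergy_succ_le (hn : 1 ≤ n) (hW : IsCombinationMatrix W)
    (hU : IsModeBasis W U l) (hf : IsSmoothObjective f L) (hlam : mixingRate W < 1) (hα : 0 ≤ α)
    (hstep : α ^ 2 * L ^ 2 * mixingRate W ^ 4 ≤ (1 - mixingRate W) ^ 2 / 648) (k : ℕ) :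
    ∫ ω, networkEnergy U l α f (x (k + 1) ω) (p (k + 1) ω) ∂P ≤
      (1 - (1 - mixingRate W) / 9) * ∫ ω, networkEnergy U l α f (x k ω) (p k ω) ∂P +
        5 * (α ^ 2 * mixingRate W ^ 4) * (n * σ ^ 2) +
        24 * (α ^ 4 * L ^ 2 * mixingRate W ^ 4) / (1 - mixingRate W) ^ 3 *
          (n * (∫ ω, ‖mean (gradStack f (x k ω))‖ ^ 2 ∂P + σ ^ 2 / n)) := by
  have ht : 0 < 1 - mixingRate W := by linarith
  have hV := hT.integrable_networkEnergy (U := U) (l := l) hf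
  have hwi : ∀ i, Integrable (fun ω => ‖(s k ω - gradStack f (x k ω)) i‖ ^ 2) P :=
    fun i => integrable_norm_sq (hT.memLp_noise k i)
  have hw : Integrable (fun ω => ∑ i, ‖(s k ω - gradStack f (x k ω)) i‖ ^ 2) P :=
    integrable_finsetSum _ fun i _ => hwi i
  have hms : Integrable (fun ω => ‖mean (s k ω)‖ ^ 2) P :=
    integrable_norm_sq (memLp_mean (hT.memLp_s hf k))
  have hin : ∀ m, Integrable (fun ω => ⟪noiseWeight U l α f (x k ω) (p k ω) m,
      mix d U.transpose (s k ω - gradStack f (x k ω)) m⟫) P := fun m =>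
    integrable_inner_of_memLp (hT.memLp_noiseWeight hf k m)
      (memLp_mix (fun i => hT.memLp_noise k i) _ m)
  -- The weight is a continuous function of `x k` and `p k`, hence predictable, and is therefore
  -- orthogonal to the centred noise.
  have hinner : ∀ m, ∫ ω, ⟪noiseWeight U l α f (x k ω) (p k ω) m,
      mix d U.transpose (s k ω - gradStack f (x k ω)) m⟫ ∂P = 0 := fun m =>
    hT.integral_inner_sum_noise k (fun i => U i m) (hT.memLp_noiseWeight hf k m)
      (hT.stronglyMeasurable_comp k (φ := fun q => noiseWeight U l α f q.1 q.2 m) (by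
        have := hf.continuous_gradient
        have hmix : ∀ M : Matrix (Fin n) (Fin n) ℝ, Continuous (mix d M) := fun M => by
          change Continuous fun (y : Fin n → Vec d) (i : Fin n) => ∑ j, M i j • y j
          fun_prop
        unfold noiseWeight consensusMode trackingMode gradMean deviation gradStack mean
        fun_prop))
  have hpt := fun ω => networkEnergy_step_le hn hW hU hf hlam hα hstep
    (w := s k ω - gradStack f (x k ω)) (add_sub_cancel _ _).symm (hT.x_succ k ω) (hT.p_succ k ω)
    (hT.mean_p hW k ω)
  have hI1 := (hV k).const_mul (1 - (1 - mixingRate W) / 9)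
  have hI2 := hw.const_mul (5 * (α ^ 2 * mixingRate W ^ 4))
  have hI3 := (hms.const_mul (n : ℝ)).const_mul
    (24 * (α ^ 4 * L ^ 2 * mixingRate W ^ 4) / (1 - mixingRate W) ^ 3)
  have hI4 := (integrable_finsetSum Finset.univ fun m _ =>
    (hin m).const_mul (α * l m ^ 2)).const_mul 2
  refine (integral_mono (hV (k + 1)) (((hI1.add hI2).add hI3).sub hI4) hpt).trans ?_
  rw [integral_sub' ((hI1.add hI2).add hI3) hI4, integral_add' (hI1.add hI2) hI3,
    integral_add' hI1 hI2]
  simp only [integral_const_mul]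
  rw [integral_finsetSum _ fun m _ => (hin m).const_mul (α * l m ^ 2),
    integral_finsetSum _ fun i _ => hwi i]
  simp only [integral_const_mul, hinner, mul_zero, Finset.sum_const_zero, sub_zero]
  have h1 : ∑ i, ∫ ω, ‖(s k ω - gradStack f (x k ω)) i‖ ^ 2 ∂P ≤ n * σ ^ 2 := by
    refine (Finset.sum_le_card_nsmul _ _ (σ ^ 2) fun i _ => hT.variance k i).trans (by simp)
  have h2 := hT.integral_norm_sq_mean_s_le hn hf k
  have hL := hf.pos
  gcongr

/-- The recursion for the expected optimality gap at the mean. -/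
lemma integral_gap_succ_le (hn : 1 ≤ n) (hW : IsCombinationMatrix W)
    (hU : IsModeBasis W U l) (hf : IsSmoothObjective f L) (hpl : IsPL f μ) (hα : 0 ≤ α) (k : ℕ) :
    ∫ ω, (avgCost f (mean (x (k + 1) ω)) - optValue f) ∂P ≤
      (1 - α * μ) * ∫ ω, (avgCost f (mean (x k ω)) - optValue f) ∂P +
        α * L ^ 2 / (2 * n) * ∫ ω, networkEnergy U l α f (x k ω) (p k ω) ∂P -
        α / 2 * (1 - α * L) * ∫ ω, ‖mean (gradStack f (x k ω))‖ ^ 2 ∂P +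
        α ^ 2 * L * σ ^ 2 / (2 * n) := by
  have hL := hf.pos
  have hn' : (n : ℝ) ≠ 0 := by positivity
  have hx := fun k => memLp_mean (hT.memLp_x hf k)
  have hgap : ∀ k, Integrable (fun ω => avgCost f (mean (x k ω)) - optValue f) P := fun k =>
    (hf.integrable_avgCost hn (hx k)).sub (integrable_const _)
  have hV := hT.integrable_networkEnergy (U := U) (l := l) hf k
  have hg := memLp_mean (hf.memLp_gradStack (hT.memLp_x hf k))
  have hgm := memLp_mean (hT.memLp_gradMean hf k)
  have hw : MemLp (fun ω => mean (s k ω - gradStack f (x k ω))) 2 P :=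
    memLp_mean fun i => hT.memLp_noise k i
  have hms : Integrable (fun ω => ‖mean (s k ω)‖ ^ 2) P :=
    integrable_norm_sq (memLp_mean (hT.memLp_s hf k))
  have hcross : ∫ ω, ⟪mean (gradMean f (x k ω)), mean (s k ω - gradStack f (x k ω))⟫ ∂P = 0 := by
    have := hT.integral_inner_sum_noise k (fun _ => 1 / (n : ℝ)) hgm
      (hT.stronglyMeasurable_comp k (φ := fun q => mean (gradMean f q.1)) (by
        have := hf.continuous_gradient
        unfold gradMean gradStack mean
        fun_prop))
    simpa only [mean, Finset.smul_sum, Pi.sub_apply] using this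
  have hpt : ∀ ω, avgCost f (mean (x (k + 1) ω)) - optValue f ≤
      (1 - α * μ) * (avgCost f (mean (x k ω)) - optValue f) +
        α * L ^ 2 / (2 * n) * networkEnergy U l α f (x k ω) (p k ω) -
        α / 2 * ‖mean (gradStack f (x k ω))‖ ^ 2 + α ^ 2 * L / 2 * ‖mean (s k ω)‖ ^ 2 -
        α * ⟪mean (gradMean f (x k ω)), mean (s k ω - gradStack f (x k ω))⟫ := by
    intro ω
    have hgrad : gradient (avgCost f) (mean (x k ω)) = mean (gradMean f (x k ω)) :=
      gradient_avgCost hf.differentiable _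
    have hm : mean (x (k + 1) ω) - mean (x k ω) = -(α • mean (s k ω)) := by
      rw [hT.x_succ, mean_sub, mean_sub, mean_smul, mean_smul, hW.mean_mix, hW.mean_mix_pow,
        hT.mean_p hW]
      module
    have h1 := hf.avgCost_le hn (mean (x k ω)) (mean (x (k + 1) ω))
    rw [hm, hgrad, norm_neg, norm_smul, mul_pow, Real.norm_eq_abs, sq_abs, inner_neg_right,
      real_inner_smul_right] at h1
    have h2 : ⟪mean (gradMean f (x k ω)), mean (s k ω)⟫ =
        ⟪mean (gradMean f (x k ω)), mean (gradStack f (x k ω))⟫ +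
        ⟪mean (gradMean f (x k ω)), mean (s k ω - gradStack f (x k ω))⟫ := by
      rw [← inner_add_right, ← mean_add, add_sub_cancel]
    -- Polarisation produces three useful terms: the gradient at the mean feeds the PL inequality,
    -- the averaged gradient is kept to pay for the network drift, and the difference is a consensus
    -- error.
    have h3 : 2 * ⟪mean (gradMean f (x k ω)), mean (gradStack f (x k ω))⟫ =
        ‖mean (gradMean f (x k ω))‖ ^ 2 + ‖mean (gradStack f (x k ω))‖ ^ 2 -
        ‖mean (gradMean f (x k ω) - gradStack f (x k ω))‖ ^ 2 := by
      rw [mean_sub, norm_sub_sq_real]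
      ring
    have h4 : ‖mean (gradMean f (x k ω) - gradStack f (x k ω))‖ ^ 2 ≤
        L ^ 2 / n * networkEnergy U l α f (x k ω) (p k ω) := by
      calc ‖mean (gradMean f (x k ω) - gradStack f (x k ω))‖ ^ 2
          ≤ (1 / (n : ℝ)) * ∑ i, ‖(gradMean f (x k ω) - gradStack f (x k ω)) i‖ ^ 2 :=
            norm_sq_avg_le hn _
        _ ≤ (1 / (n : ℝ)) * ∑ i, L ^ 2 * ‖deviation (x k ω) i‖ ^ 2 := by
            gcongr with i
            rw [← mul_pow, Pi.sub_apply, norm_sub_rev]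
            exact pow_le_pow_left₀ (norm_nonneg _) (hf.lipschitz i _ _) 2
        _ = L ^ 2 / n * ∑ i, ‖deviation (x k ω) i‖ ^ 2 := by
            rw [← Finset.mul_sum]
            ring
        _ ≤ _ := by
            gcongr
            exact sum_norm_sq_deviation_le_networkEnergy hU _ _
    have h5 := hpl.ineq (mean (x k ω))
    rw [hgrad] at h5
    have h6 := mul_le_mul_of_nonneg_left h4 (by positivity : 0 ≤ α / 2)
    have h7 := mul_le_mul_of_nonneg_left h5 (by positivity : 0 ≤ α / 2)
    have h8 : α / 2 * (L ^ 2 / n * networkEnergy U l α f (x k ω) (p k ω)) =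
        α * L ^ 2 / (2 * n) * networkEnergy U l α f (x k ω) (p k ω) := by
      field_simp
    rw [h8] at h6
    rw [h2] at h1
    have h9 := congrArg (fun z => α / 2 * z) h3
    linarith
  have hI1 := (hgap k).const_mul (1 - α * μ)
  have hI2 := hV.const_mul (α * L ^ 2 / (2 * n))
  have hI3 := (integrable_norm_sq hg).const_mul (α / 2)
  have hI4 := hms.const_mul (α ^ 2 * L / 2)
  have hI5 := (integrable_inner_of_memLp hgm hw).const_mul α
  refine (integral_mono (hgap (k + 1)) ((((hI1.add hI2).sub hI3).add hI4).sub hI5) hpt).trans ?_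
  rw [integral_sub' (((hI1.add hI2).sub hI3).add hI4) hI5, integral_add' ((hI1.add hI2).sub hI3) hI4,
    integral_sub' (hI1.add hI2) hI3, integral_add' hI1 hI2]
  simp only [integral_const_mul]
  rw [hcross]
  have h2 := mul_le_mul_of_nonneg_left (hT.integral_norm_sq_mean_s_le hn hf k)
    (by positivity : 0 ≤ α ^ 2 * L / 2)
  have e : α ^ 2 * L * σ ^ 2 / (2 * n) = α ^ 2 * L / 2 * (σ ^ 2 / n) := by field_simp
  rw [e]
  linarith

/-- The averaged expected error is controlled by the gap at the mean and the network energy. -/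
lemma avg_integral_gap_le (hn : 1 ≤ n) (hU : IsModeBasis W U l) (hf : IsSmoothObjective f L)
    (k : ℕ) :
    (1 / (n : ℝ)) * ∑ i, ∫ ω, (avgCost f (x k ω i) - optValue f) ∂P ≤
      ∫ ω, (avgCost f (mean (x k ω)) - optValue f) ∂P +
        L / (2 * n) * ∫ ω, networkEnergy U l α f (x k ω) (p k ω) ∂P := by
  have hL := hf.pos
  have hn' : (n : ℝ) ≠ 0 := by positivity
  have hgap : Integrable (fun ω => avgCost f (mean (x k ω)) - optValue f) P :=
    (hf.integrable_avgCost hn (memLp_mean (hT.memLp_x hf k))).sub (integrable_const _)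
  have hgi : ∀ i, Integrable (fun ω => avgCost f (x k ω i) - optValue f) P := fun i =>
    (hf.integrable_avgCost hn (hT.memLp_x hf k i)).sub (integrable_const _)
  have hV := hT.integrable_networkEnergy (U := U) (l := l) hf k
  rw [← integral_finsetSum _ fun i _ => hgi i, ← integral_const_mul, ← integral_const_mul,
    ← integral_add hgap (hV.const_mul _)]
  refine integral_mono ((integrable_finsetSum _ fun i _ => hgi i).const_mul _)
    (hgap.add (hV.const_mul _)) fun ω => ?_
  have h1 : ∑ i, (avgCost f (x k ω i) - optValue f) ≤ ∑ i, ((avgCost f (mean (x k ω)) - optValue f)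
      + ⟪gradient (avgCost f) (mean (x k ω)), deviation (x k ω) i⟫ +
        L / 2 * ‖deviation (x k ω) i‖ ^ 2) :=
    Finset.sum_le_sum fun i _ => by
      have := hf.avgCost_le hn (mean (x k ω)) (x k ω i)
      simp only [deviation]
      linarith
  -- Deviations from the mean sum to zero, so the first-order terms cancel on averaging over the
  -- agents.
  rw [Finset.sum_add_distrib, Finset.sum_add_distrib, ← inner_sum, sum_deviation hn, inner_zero_right,
    ← Finset.mul_sum, Finset.sum_const, Finset.card_univ, Fintype.card_fin, nsmul_eq_mul,
    add_zero] at h1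
  have h2 := sum_norm_sq_deviation_le_networkEnergy (α := α) (f := f) hU (x k ω) (p k ω)
  calc (1 / (n : ℝ)) * ∑ i, (avgCost f (x k ω i) - optValue f)
      ≤ (1 / (n : ℝ)) * (n * (avgCost f (mean (x k ω)) - optValue f) +
          L / 2 * networkEnergy U l α f (x k ω) (p k ω)) := by
        gcongr
        exact h1.trans (by gcongr)
    _ = _ := by field_simp

end IsTrackingDynamics

end TrackingDynamics

/-! ### The coupled scalar recursions -/

section Lyapunov

/-- A Lyapunov argument for the coupled recursions of the optimality gap `r` and the network
error `v`, where `G` is the squared norm of the averaged gradient. -/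
lemma coupled_recursion_bound {α L μ t lam S N : ℝ} (hα : 0 < α) (hμ : 0 < μ)
    (hμL : μ ≤ L) (ht : 0 < t) (ht1 : t ≤ 1) (hN : 0 < N) (hS : 0 ≤ S)
    (hstep1 : α * L ≤ t / 6) (hstep2 : α ^ 2 * L ^ 2 * lam ^ 4 ≤ t ^ 2 / 648)
    {r v G : ℕ → ℝ} (hr : ∀ k, 0 ≤ r k) (hv : ∀ k, 0 ≤ v k) (hG : ∀ k, 0 ≤ G k)
    (hrec : ∀ k, r (k + 1) ≤ (1 - α * μ) * r k + α * L ^ 2 / 2 * v k -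
      α / 2 * (1 - α * L) * G k + α ^ 2 * L * S / (2 * N))
    (hvec : ∀ k, v (k + 1) ≤ (1 - t / 9) * v k + 5 * (α ^ 2 * lam ^ 4) * S +
      24 * (α ^ 4 * L ^ 2 * lam ^ 4) / t ^ 3 * (G k + S / N)) (k : ℕ) :
    r k + L / 2 * v k ≤ (1 - α * μ / 2) ^ k * (r 0 + 3 * L * v 0) +
      324 * (α * L * S / (μ * N) + α ^ 2 * L ^ 2 * lam ^ 4 * S / (μ * t) +
        α ^ 4 * L ^ 4 * lam ^ 4 * S / (μ * t ^ 4 * N)) := by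
  have hL : 0 < L := hμ.trans_le hμL
  have hq1 : α * μ ≤ t / 6 := (mul_le_mul_of_nonneg_left hμL hα.le).trans hstep1
  set c := 24 * (α ^ 4 * L ^ 2 * lam ^ 4) / t ^ 3 with hc
  have hc0 : 0 ≤ c := by positivity
  -- `M` is the level at which the noise input balances the contraction `t/9`.
  set M := 9 / t * (5 * (α ^ 2 * lam ^ 4) * S + c * (S / N)) with hM
  have hM0 : 0 ≤ M := by positivity
  have hMt : t / 9 * M = 5 * (α ^ 2 * lam ^ 4) * S + c * (S / N) := by
    rw [hM]; field_simp
  -- Only the excess over `M` enters the potential. If the input `α² lam⁴ S` were kept inside the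
  -- weighted sum, division by `q = α μ / 2` would leave a term of order `α` without `1/N`. As
  -- arranged, `M` enters through the coupling `α L² / 2`, and the factor `α` cancels. Truncation at
  -- zero keeps the potential nonnegative.
  set w : ℕ → ℝ := fun k => max (v k - M) 0 with hw
  have hw0 : ∀ k, 0 ≤ w k := fun k => le_max_right _ _
  have hvw : ∀ k, v k ≤ w k + M := fun k => by linarith [le_max_left (v k - M) 0]
  have hwrec : ∀ k, w (k + 1) ≤ (1 - t / 9) * w k + c * G k := by
    intro k
    have h0 : 0 ≤ (1 - t / 9) * w k := mul_nonneg (by linarith) (hw0 k)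
    have h1 : 0 ≤ c * G k := mul_nonneg hc0 (hG k)
    refine max_le ?_ (add_nonneg h0 h1)
    have h2 : (1 - t / 9) * (v k - M) ≤ (1 - t / 9) * w k :=
      mul_le_mul_of_nonneg_left (le_max_left _ _) (by linarith)
    have h3 := hvec k
    linarith
  -- The gradient term of the network recursion, with weight `3 L`, is covered by the negative
  -- gradient term of the gap recursion.
  have hcL : 3 * L * c ≤ α / 2 * (1 - α * L) := by
    have e : 3 * L * c = 72 * α * ((α * L) * (α ^ 2 * L ^ 2 * lam ^ 4)) / t ^ 3 := by
      rw [hc]; ring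
    rw [e]
    calc 72 * α * ((α * L) * (α ^ 2 * L ^ 2 * lam ^ 4)) / t ^ 3
        ≤ 72 * α * ((t / 6) * (t ^ 2 / 648)) / t ^ 3 := by gcongr
      _ = α / 54 := by field_simp; norm_num
      _ ≤ α / 2 * (1 - α * L) := by nlinarith
  set q := α * μ / 2 with hq
  set B := α * L ^ 2 / 2 * M + α ^ 2 * L * S / (2 * N) with hB
  have hE : ∀ k, r (k + 1) + 3 * L * w (k + 1) ≤ (1 - q) * (r k + 3 * L * w k) + B := by
    intro k
    have h1 := hrec k
    have h2 := mul_le_mul_of_nonneg_left (hwrec k) (by positivity : 0 ≤ 3 * L)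
    have h3 := mul_le_mul_of_nonneg_left (hvw k) (by positivity : 0 ≤ α * L ^ 2 / 2)
    have h4 := mul_le_mul_of_nonneg_right hcL (hG k)
    have h5 : 0 ≤ q * r k := mul_nonneg (by positivity) (hr k)
    -- `α L / 2 ≤ t / 12` and `3 q ≤ t / 4` exhaust `t / 3` exactly; `3 L` is the smallest weight
    -- for which these bounds suffice.
    have h6 : 0 ≤ L * (t / 3 - α * L / 2 - 3 * q) * w k :=
      mul_nonneg (mul_nonneg hL.le (by rw [hq]; linarith)) (hw0 k)
    have h7 : q * r k = α * μ * r k / 2 := by rw [hq]; ring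
    rw [hB]
    linarith
  have hq0 : 0 < q := by positivity
  have hqB : ∀ k, r k + 3 * L * w k ≤ (1 - q) ^ k * (r 0 + 3 * L * w 0) + B / q := by
    intro k
    induction k with
    | zero =>
      have : 0 ≤ B / q := by positivity
      simpa using this
    | succ k ih =>
      have h1 := mul_le_mul_of_nonneg_left ih (by rw [hq]; linarith : 0 ≤ 1 - q)
      have h2 : (1 - q) * (B / q) + B = B / q := by field_simp; ring
      rw [pow_succ]
      linarith [hE k]
  have hBq : B / q = L ^ 2 / μ * M + α * L * S / (μ * N) := by
    rw [hB, hq]; field_simp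
  have hw00 : w 0 ≤ v 0 := max_le (by linarith) (hv 0)
  have h1 : (1 - q) ^ k * (r 0 + 3 * L * w 0) ≤ (1 - q) ^ k * (r 0 + 3 * L * v 0) := by
    have : 0 ≤ 1 - q := by rw [hq]; linarith
    gcongr
  have h2 : L / 2 * M ≤ L ^ 2 / μ * M / 2 := by
    rw [mul_div_right_comm]
    gcongr
    rw [le_div_iff₀ hμ]
    nlinarith
  -- The factor `3/2` combines `M` from the potential with the half from `L / 2 * M`; the constant
  -- `324` is `9 * 24 * 3/2`.
  have h3 : L ^ 2 / μ * M * (3 / 2) = 135 / 2 * (α ^ 2 * L ^ 2 * lam ^ 4 * S / (μ * t)) +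
      324 * (α ^ 4 * L ^ 4 * lam ^ 4 * S / (μ * t ^ 4 * N)) := by
    rw [hM, hc]; field_simp; ring
  have h4 := hqB k
  rw [hBq] at h4
  have h5 := mul_le_mul_of_nonneg_left (hvw k) (by positivity : 0 ≤ L / 2)
  have h6 : 0 ≤ L * w k := mul_nonneg hL.le (hw0 k)
  have h7 : 0 ≤ α * L * S / (μ * N) := by positivity
  have h8 : 0 ≤ α ^ 2 * L ^ 2 * lam ^ 4 * S / (μ * t) := by positivity
  linarith

end Lyapunov

/-! ### ATC-GT as a tracking dynamics -/

section Algorithm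

open scoped RealInnerProductSpace

variable {n d : ℕ} {Ω : Type*} {Ξ : Fin n → Type*}
  {W : Matrix (Fin n) (Fin n) ℝ} {f : Fin n → Vec d → ℝ}
  {F : (i : Fin n) → Vec d → Ξ i → ℝ} {ξ : (i : Fin n) → ℕ → Ω → Ξ i}
  {x0 : Vec d} {L μ σ α : ℝ}

/-- The sampled gradients along the trajectory of ATC-GT. -/
noncomputable def atcGTGrad (W : Matrix (Fin n) (Fin n) ℝ)
    (F : (i : Fin n) → Vec d → Ξ i → ℝ) (ξ : (i : Fin n) → ℕ → Ω → Ξ i)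
    (x0 : Vec d) (α : ℝ) (k : ℕ) (ω : Ω) : Fin n → Vec d :=
  stochGrad F ξ ω k (atcGTIterate W F ξ x0 α k ω)

/-- The predictable part of the mixed trackers of ATC-GT. -/
noncomputable def atcGTPredictable (W : Matrix (Fin n) (Fin n) ℝ)
    (F : (i : Fin n) → Vec d → Ξ i → ℝ) (ξ : (i : Fin n) → ℕ → Ω → Ξ i)
    (x0 : Vec d) (α : ℝ) (k : ℕ) (ω : Ω) : Fin n → Vec d :=
  mix d W ((atcGT W F ξ x0 α ω k).2 - mix d W (atcGTGrad W F ξ x0 α k ω))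

lemma atcGTPredictable_zero (ω : Ω) : atcGTPredictable W F ξ x0 α 0 ω = 0 := by
  have : (atcGT W F ξ x0 α ω 0).2 = mix d W (atcGTGrad W F ξ x0 α 0 ω) := rfl
  rw [atcGTPredictable, this, sub_self, map_zero]

lemma atcGTIterate_succ (k : ℕ) (ω : Ω) :
    atcGTIterate W F ξ x0 α (k + 1) ω = mix d W (atcGTIterate W F ξ x0 α k ω) -
      α • atcGTPredictable W F ξ x0 α k ω - α • mix d (W ^ 2) (atcGTGrad W F ξ x0 α k ω) := by
  have : atcGTIterate W F ξ x0 α (k + 1) ω =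
    mix d W (atcGTIterate W F ξ x0 α k ω - α • (atcGT W F ξ x0 α ω k).2) := rfl
  rw [this, atcGTPredictable, map_sub, map_sub, map_smul, pow_two, mix_mul]
  module

/-- The newest gradient cancels: `g' - W s' = W (g - s)`, so the next value of `p` uses only samples
up to time `k`. -/
lemma atcGTPredictable_succ (k : ℕ) (ω : Ω) :
    atcGTPredictable W F ξ x0 α (k + 1) ω = mix d W (atcGTPredictable W F ξ x0 α k ω) -
      mix d (W ^ 2) (atcGTGrad W F ξ x0 α k ω) + mix d (W ^ 3) (atcGTGrad W F ξ x0 α k ω) := by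
  have : (atcGT W F ξ x0 α ω (k + 1)).2 = mix d W ((atcGT W F ξ x0 α ω k).2 +
    atcGTGrad W F ξ x0 α (k + 1) ω - atcGTGrad W F ξ x0 α k ω) := rfl
  rw [atcGTPredictable, this, atcGTPredictable, pow_two, pow_three, mix_mul, mix_mul, mix_mul]
  simp only [map_sub, map_add]
  abel

lemma measurable_mix (M : Matrix (Fin n) (Fin n) ℝ) : Measurable (mix d M) := by
  have : Continuous (mix d M) := by
    change Continuous fun (y : Fin n → Vec d) (i : Fin n) => ∑ j, M i j • y j
    fun_prop
  exact this.measurable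

lemma measurable_pastSigma (x : ℕ → Ω → Fin n → Vec d) {j k : ℕ} (hjk : j ≤ k) :
    Measurable[pastSigma x k] (x j) :=
  Measurable.of_comap_le (le_iSup₂_of_le j hjk le_rfl)

/-- The σ-algebra contains iterates but no samples, so the sampled gradients themselves need not be
measurable. Only `W² s` enters, and since `α ≠ 0` it can be read off from two consecutive iterates
and `p`. -/
lemma measurable_atcGTPredictable (hα : α ≠ 0) (k : ℕ) :
    Measurable[pastSigma (atcGTIterate W F ξ x0 α) k] (atcGTPredictable W F ξ x0 α k) := by
  induction k with
  | zero =>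
    have : atcGTPredictable W F ξ x0 α 0 = fun _ => 0 := funext atcGTPredictable_zero
    rw [this]
    exact measurable_const
  | succ k ih =>
    have hmono : pastSigma (atcGTIterate W F ξ x0 α) k ≤
        pastSigma (atcGTIterate W F ξ x0 α) (k + 1) :=
      iSup₂_le fun j hj => le_iSup₂_of_le j (hj.trans k.le_succ) le_rfl
    have hp := ih.mono hmono le_rfl
    have hx := measurable_pastSigma (atcGTIterate W F ξ x0 α) k.le_succ
    have hx' := measurable_pastSigma (atcGTIterate W F ξ x0 α) (le_refl (k + 1))
    have hsq : (fun ω => mix d (W ^ 2) (atcGTGrad W F ξ x0 α k ω)) = fun ω =>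
        α⁻¹ • (mix d W (atcGTIterate W F ξ x0 α k ω) - α • atcGTPredictable W F ξ x0 α k ω -
          atcGTIterate W F ξ x0 α (k + 1) ω) := by
      ext1 ω
      rw [atcGTIterate_succ, sub_sub_cancel, inv_smul_smul₀ hα]
    have hs : Measurable[pastSigma (atcGTIterate W F ξ x0 α) (k + 1)]
        fun ω => mix d (W ^ 2) (atcGTGrad W F ξ x0 α k ω) := by
      rw [hsq]
      exact ((((measurable_mix W).comp hx).sub (hp.const_smul α)).sub hx').const_smul α⁻¹
    have e : atcGTPredictable W F ξ x0 α (k + 1) = fun ω =>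
        mix d W (atcGTPredictable W F ξ x0 α k ω) - mix d (W ^ 2) (atcGTGrad W F ξ x0 α k ω) +
          mix d W (mix d (W ^ 2) (atcGTGrad W F ξ x0 α k ω)) := by
      ext1 ω
      rw [atcGTPredictable_succ, ← mix_mul, ← pow_succ']
    rw [e]
    exact (((measurable_mix W).comp hp).sub hs).add ((measurable_mix W).comp hs)

variable [∀ i, MeasurableSpace (Ξ i)]

lemma measurable_stochGrad {m : MeasurableSpace Ω} {i : Fin n} {k : ℕ}
    (hF : Measurable fun q : Vec d × Ξ i => gradient (fun z => F i z q.2) q.1)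
    (hξ : Measurable[m] (ξ i k)) {y : Ω → Fin n → Vec d} (hy : Measurable[m] y) :
    Measurable[m] fun ω => stochGrad F ξ ω k (y ω) i :=
  hF.comp (((measurable_pi_apply i).comp hy).prodMk hξ)

lemma IsSmoothObjective.measurable_gradNoise {m : MeasurableSpace Ω} {i : Fin n} {k : ℕ}
    {x : ℕ → Ω → Fin n → Vec d} (hf : IsSmoothObjective f L)
    (hF : Measurable fun q : Vec d × Ξ i => gradient (fun z => F i z q.2) q.1)
    (hξ : Measurable[m] (ξ i k)) (hx : Measurable[m] (x k)) :
    Measurable[m] (gradNoise f F ξ x i k) :=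
  (measurable_stochGrad hF hξ hx).sub
    ((hf.continuous_gradient i).measurable.comp ((measurable_pi_apply i).comp hx))

variable [mΩ : MeasurableSpace Ω] {P : Measure Ω}

namespace NoiseAssumption

variable [IsProbabilityMeasure P] (h : NoiseAssumption P f F ξ (atcGTIterate W F ξ x0 α) σ)
include h

omit [IsProbabilityMeasure P] in
lemma measurable_atcGT (k : ℕ) :
    Measurable (atcGTIterate W F ξ x0 α k) ∧ Measurable fun ω => (atcGT W F ξ x0 α ω k).2 := by
  have hs : ∀ k, Measurable (atcGTIterate W F ξ x0 α k) →
      Measurable (atcGTGrad W F ξ x0 α k) := fun k hx =>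
    measurable_pi_lambda _ fun i =>
      measurable_stochGrad (h.measurable_grad i) (h.measurable_sample i k) hx
  induction k with
  | zero =>
    have hx : Measurable (atcGTIterate W F ξ x0 α 0) := measurable_const
    exact ⟨hx, (measurable_mix W).comp (hs 0 hx)⟩
  | succ k ih =>
    have hx : Measurable (atcGTIterate W F ξ x0 α (k + 1)) :=
      (measurable_mix W).comp (ih.1.sub (ih.2.const_smul α))
    exact ⟨hx, (measurable_mix W).comp ((ih.2.add (hs (k + 1) hx)).sub (hs k ih.1))⟩

omit [IsProbabilityMeasure P] in
lemma pastSigma_le (k : ℕ) : pastSigma (atcGTIterate W F ξ x0 α) k ≤ mΩ :=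
  iSup₂_le fun j _ => (h.measurable_atcGT j).1.comap_le

lemma isTrackingDynamics (hf : IsSmoothObjective f L) (hα : α ≠ 0) :
    IsTrackingDynamics P W f α σ x0 (pastSigma (atcGTIterate W F ξ x0 α))
      (atcGTIterate W F ξ x0 α) (atcGTPredictable W F ξ x0 α) (atcGTGrad W F ξ x0 α) where
  le := h.pastSigma_le
  x_zero _ := rfl
  p_zero := atcGTPredictable_zero
  x_succ := atcGTIterate_succ
  p_succ := atcGTPredictable_succ
  measurable_x k := measurable_pastSigma _ le_rfl
  measurable_p := measurable_atcGTPredictable hα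
  memLp_noise k i := h.memLp i k
  unbiased k i := h.unbiased i k
  variance k i := by
    have h1 := integral_mono_ae integrable_condExp (integrable_const _) (h.variance i k)
    rw [integral_condExp (h.pastSigma_le k)] at h1
    rw [integral_const, probReal_univ, one_smul] at h1
    exact h1
  uncorrelated k i j hij := by
    have hmeas : ∀ i, StronglyMeasurable[pastSigma (atcGTIterate W F ξ x0 α) k ⊔
        MeasurableSpace.comap (ξ i k) inferInstance]
        (gradNoise f F ξ (atcGTIterate W F ξ x0 α) i k) := fun i =>
      (hf.measurable_gradNoise (x := atcGTIterate W F ξ x0 α)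
        (m := pastSigma (atcGTIterate W F ξ x0 α) k ⊔ MeasurableSpace.comap (ξ i k) inferInstance)
        (h.measurable_grad i)
        ((comap_measurable (ξ i k)).mono le_sup_right le_rfl)
        ((measurable_pastSigma (atcGTIterate W F ξ x0 α) le_rfl).mono le_sup_left le_rfl)).stronglyMeasurable
    refine integral_inner_eq_zero_of_condIndep (h.pastSigma_le k) (h.measurable_sample i k)
      (h.measurable_sample j k) ?_ (h.memLp i k) (hmeas i) (h.memLp j k) (hmeas j) (h.unbiased j k)
    intro A B hA hB
    classical
    -- A family equal to `A` at `i` and to `B` at `j`; its other values do not matter for the pair.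
    have key := h.condIndep k {i, j}
      (Function.update (Function.update (fun _ => Set.univ) i A) j B) (by
        intro a ha
        rcases Finset.mem_insert.mp ha with rfl | ha
        · simpa [Function.update_of_ne hij] using hA
        · rw [Finset.mem_singleton.mp ha]
          simpa using hB)
    rw [Finset.set_biInter_insert, Finset.set_biInter_singleton, Finset.prod_pair hij] at key
    simpa [Function.update_of_ne hij] using key

end NoiseAssumption

namespace StandingAssumptions

variable [IsProbabilityMeasure P] (h : StandingAssumptions P W f F ξ x0 L μ σ α)
include h

lemma integrable_avgCost_iterate (hα : α ≠ 0) (k : ℕ) (i : Fin n) :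
    Integrable (fun ω => avgCost f (atcGTIterate W F ξ x0 α k ω i)) P :=
  h.smooth.integrable_avgCost h.one_le
    ((h.noise.isTrackingDynamics h.smooth hα).memLp_x h.smooth k i)

/-- Applies `coupled_recursion_bound` to the gap at the mean and the network energy per agent, both
in expectation. -/
lemma expectedError_le (hs : StepSizeOK L μ (mixingRate W) α) (k : ℕ) :
    expectedError P W f F ξ x0 α k ≤
      (1 - α * μ / 2) ^ k * (2 * (avgCost f x0 - optValue f) +
          27 * α ^ 2 * L * zetaSq W f x0 / (1 - mixingRate W) ^ 2) +
        324 * (α * L * σ ^ 2 / (μ * n) +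
          α ^ 2 * L ^ 2 * mixingRate W ^ 4 * σ ^ 2 / (μ * (1 - mixingRate W)) +
          α ^ 4 * L ^ 4 * mixingRate W ^ 4 * σ ^ 2 / (μ * (1 - mixingRate W) ^ 4 * n)) := by
  have hn := h.one_le
  have hn' : (0 : ℝ) < n := by positivity
  have hα := hs.pos
  have hf := h.smooth
  have hL := hf.pos
  have hμ := h.pl.pos
  obtain ⟨hlam0, hlam1, U, l, hU⟩ := exists_modeBasis hn h.combination h.posSemidef
  have hT := h.noise.isTrackingDynamics hf hα.ne'
  have ht : 0 < 1 - mixingRate W := by linarith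
  have hstep1 : α * L ≤ (1 - mixingRate W) / 6 := by
    have := hs.le_first
    rw [le_div_iff₀ (by positivity)] at this
    linarith
  have hstep2 : α ^ 2 * L ^ 2 * mixingRate W ^ 4 ≤ (1 - mixingRate W) ^ 2 / 648 := by
    rcases eq_or_ne (mixingRate W) 0 with h0 | h0
    · rw [h0]; norm_num
    · have h1 := hs.le_second h0
      rw [le_div_iff₀ (by positivity)] at h1
      have h2 := pow_le_pow_left₀ (by positivity) h1 2
      -- `648 = 6² * 18`: squaring the second threshold gives exactly the bound used by the network
      -- recursion.
      have h3 : (α * (6 * √18 * L * mixingRate W ^ 2)) ^ 2 =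
          648 * (α ^ 2 * L ^ 2 * mixingRate W ^ 4) := by
        rw [show (α * (6 * √18 * L * mixingRate W ^ 2)) ^ 2 =
          36 * (√18) ^ 2 * (α ^ 2 * L ^ 2 * mixingRate W ^ 4) by ring, Real.sq_sqrt (by norm_num)]
        ring
      linarith
  have hgap : 0 ≤ avgCost f x0 - optValue f := sub_nonneg.mpr (hf.optValue_le x0)
  have hbound := coupled_recursion_bound (lam := mixingRate W) (S := σ ^ 2) (N := n) hα hμ h.mu_le
    ht (by linarith) hn' (sq_nonneg σ) hstep1 hstep2
    (r := fun k => ∫ ω, (avgCost f (mean (atcGTIterate W F ξ x0 α k ω)) - optValue f) ∂P)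
    (v := fun k => (1 / (n : ℝ)) * ∫ ω, networkEnergy U l α f (atcGTIterate W F ξ x0 α k ω)
      (atcGTPredictable W F ξ x0 α k ω) ∂P)
    (G := fun k => ∫ ω, ‖mean (gradStack f (atcGTIterate W F ξ x0 α k ω))‖ ^ 2 ∂P)
    (fun k => integral_nonneg fun ω => sub_nonneg.mpr (hf.optValue_le _))
    (fun k => mul_nonneg (by positivity) (integral_nonneg fun ω => networkEnergy_nonneg _ _))
    (fun k => integral_nonneg fun ω => by positivity)
    (fun k => by
      refine (hT.integral_gap_succ_le hn h.combination hU hf h.pl hα.le k).trans (le_of_eq ?_)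
      field_simp)
    (fun k => by
      have := mul_le_mul_of_nonneg_left (hT.integral_networkEnergy_succ_le hn h.combination hU hf
        hlam1 hα.le hstep2 k) (by positivity : 0 ≤ 1 / (n : ℝ))
      refine this.trans (le_of_eq ?_)
      field_simp) k
  have herr := hT.avg_integral_gap_le hn hU hf k
  have hv0 : (1 / (n : ℝ)) * ∫ ω, networkEnergy U l α f (atcGTIterate W F ξ x0 α 0 ω)
      (atcGTPredictable W F ξ x0 α 0 ω) ∂P ≤
      2 * (α ^ 2 / (1 - mixingRate W) ^ 2 * zetaSq W f x0) := by
    have e : ∀ ω, networkEnergy U l α f (atcGTIterate W F ξ x0 α 0 ω)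
        (atcGTPredictable W F ξ x0 α 0 ω) = networkEnergy U l α f (fun _ => x0) 0 := fun ω => by
      rw [hT.x_zero, hT.p_zero]
    simp only [e, integral_const, probReal_univ, one_smul]
    have := mul_le_mul_of_nonneg_left (networkEnergy_zero_le (α := α) hn h.combination hU hf hlam1 x0)
      (by positivity : 0 ≤ 1 / (n : ℝ))
    refine this.trans (le_of_eq ?_)
    field_simp
  have hr0 : ∫ ω, (avgCost f (mean (atcGTIterate W F ξ x0 α 0 ω)) - optValue f) ∂P =
      avgCost f x0 - optValue f := by
    simp only [hT.x_zero, mean_const hn, integral_const, probReal_univ, one_smul]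
  have hz : 0 ≤ zetaSq W f x0 :=
    mul_nonneg (by positivity) (Finset.sum_nonneg fun _ _ => by positivity)
  have hq : 0 ≤ 1 - α * μ / 2 := by nlinarith [h.mu_le]
  have hinit : avgCost f x0 - optValue f + 3 * L * ((1 / (n : ℝ)) *
      ∫ ω, networkEnergy U l α f (atcGTIterate W F ξ x0 α 0 ω)
        (atcGTPredictable W F ξ x0 α 0 ω) ∂P) ≤
      2 * (avgCost f x0 - optValue f) +
        27 * α ^ 2 * L * zetaSq W f x0 / (1 - mixingRate W) ^ 2 := by
    have h1 := mul_le_mul_of_nonneg_left hv0 (by positivity : 0 ≤ 3 * L)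
    have h2 : 3 * L * (2 * (α ^ 2 / (1 - mixingRate W) ^ 2 * zetaSq W f x0)) =
      6 * (α ^ 2 * L * zetaSq W f x0 / (1 - mixingRate W) ^ 2) := by ring
    have h3 : 27 * α ^ 2 * L * zetaSq W f x0 / (1 - mixingRate W) ^ 2 =
      27 * (α ^ 2 * L * zetaSq W f x0 / (1 - mixingRate W) ^ 2) := by ring
    have h4 : 0 ≤ α ^ 2 * L * zetaSq W f x0 / (1 - mixingRate W) ^ 2 := by positivity
    linarith
  simp only [hr0] at hbound
  have hpow := mul_le_mul_of_nonneg_left hinit (pow_nonneg hq k)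
  have e : L / (2 * n) * ∫ ω, networkEnergy U l α f (atcGTIterate W F ξ x0 α k ω)
      (atcGTPredictable W F ξ x0 α k ω) ∂P = L / 2 * ((1 / (n : ℝ)) *
      ∫ ω, networkEnergy U l α f (atcGTIterate W F ξ x0 α k ω)
      (atcGTPredictable W F ξ x0 α k ω) ∂P) := by field_simp
  rw [e] at herr
  rw [expectedError]
  linarith

end StandingAssumptions

end Algorithm

/-! ### The logarithmic step size -/

section LogStep

variable {μ L t : ℝ} {K : ℕ}

lemma logStep_eq (μ : ℝ) (K : ℕ) : logStep μ K = 4 * Real.log K / (μ * K) := by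
  rw [logStep, Real.log_pow]
  push_cast
  ring

/-- At `K = 0`, by the convention for `Real.log 0`, and at `K = 1` the logarithm vanishes. -/
lemma two_le_of_logStep_pos (h : 0 < logStep μ K) : 2 ≤ K := by
  by_contra! hK
  interval_cases K <;> simp [logStep] at h

lemma half_le_log (hK : 2 ≤ K) : 1 / 2 ≤ Real.log K := by
  have h1 : Real.log 2 ≤ Real.log K := Real.log_le_log (by norm_num) (by exact_mod_cast hK)
  linarith [Real.log_two_gt_d9]

lemma one_sub_logStep_pow_le (hμ : 0 < μ) (hK : 2 ≤ K) (h : 0 ≤ 1 - logStep μ K * μ / 2) :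
    (1 - logStep μ K * μ / 2) ^ K ≤ 1 / (K : ℝ) ^ 2 := by
  have hK0 : (0 : ℝ) < K := by positivity
  calc (1 - logStep μ K * μ / 2) ^ K ≤ Real.exp (-(logStep μ K * μ / 2)) ^ K :=
        pow_le_pow_left₀ h (Real.one_sub_le_exp_neg _) K
    _ = Real.exp (-Real.log ((K : ℝ) ^ 2)) := by
        rw [← Real.exp_nat_mul, logStep]
        congr 1
        field_simp
    _ = 1 / (K : ℝ) ^ 2 := by
        rw [Real.exp_neg, Real.exp_log (by positivity), one_div]

/-- The factor between the mixing gap and the largest step size that is admissible for it. -/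
noncomputable def stepFactor (μ L : ℝ) : ℝ :=
  min (1 / (6 * √18 * L)) ((μ / (432 * L ^ 4)) ^ (1 / 3 : ℝ))

lemma stepFactor_pos (hμ : 0 < μ) (hL : 0 < L) : 0 < stepFactor μ L :=
  lt_min (by positivity) (by positivity)

/-- Every threshold is at least a constant times `1 - λ`: the factor `λ²` in a denominator only
helps, and the cube root of `(1 - λ)³` is linear. -/
lemma stepSizeOK_of_le {lam α : ℝ} (hμ : 0 < μ) (hL : 0 < L) (h0 : 0 ≤ lam) (h1 : lam < 1)
    (hα : 0 < α) (h : α ≤ stepFactor μ L * (1 - lam)) : StepSizeOK L μ lam α := by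
  have ht : 0 < 1 - lam := by linarith
  have hs : 1 ≤ √(18 : ℝ) := Real.one_le_sqrt.mpr (by norm_num)
  have ha : α ≤ (1 - lam) / (6 * √18 * L) := by
    refine h.trans ?_
    rw [← one_div_mul_eq_div]
    exact mul_le_mul_of_nonneg_right (min_le_left _ _) ht.le
  refine ⟨hα, ha.trans ?_, fun hne => ha.trans ?_, h.trans ?_⟩
  · gcongr
    linarith
  · have hlam : 0 < lam := lt_of_le_of_ne h0 hne.symm
    refine div_le_div_of_nonneg_left ht.le (by positivity) ?_
    exact mul_le_of_le_one_right (by positivity) (pow_le_one₀ h0 h1.le)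
  · have e : (μ * (1 - lam) ^ 3 / (432 * L ^ 4)) ^ (1 / 3 : ℝ) =
        (μ / (432 * L ^ 4)) ^ (1 / 3 : ℝ) * (1 - lam) := by
      rw [mul_div_right_comm, Real.mul_rpow (by positivity) (by positivity)]
      congr 1
      have := Real.pow_rpow_inv_natCast ht.le (n := 3) (by norm_num)
      simpa using this
    rw [e]
    exact mul_le_mul_of_nonneg_right (min_le_right _ _) ht.le

/-- The exponent `4/3` exceeds the `1` that scaling would require, and the surplus absorbs the
logarithm: `ln K ≤ 4 K^(1/4)`, while the hypothesis bounds `K^(3/4)` below by `16 / (μ a t)`. -/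
lemma logStep_le_of_rpow_le {a : ℝ} (hμ : 0 < μ) (ha : 0 < a) (ht : 0 < t) (hK : 2 ≤ K)
    (h : (16 / (μ * a)) ^ (4 / 3 : ℝ) * (1 / t ^ (4 / 3 : ℝ)) ≤ K) : logStep μ K ≤ a * t := by
  have hK0 : (0 : ℝ) < K := by positivity
  have h1 : (16 / (μ * a) / t) ^ (4 / 3 : ℝ) ≤ K := by
    rw [Real.div_rpow (by positivity) ht.le]
    simpa [div_eq_mul_inv] using h
  have h2 : 16 / (μ * a) / t ≤ (K : ℝ) ^ (3 / 4 : ℝ) := by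
    have := Real.rpow_le_rpow (by positivity) h1 (by norm_num : (0 : ℝ) ≤ 3 / 4)
    rwa [← Real.rpow_mul (by positivity), show (4 / 3 : ℝ) * (3 / 4) = 1 by norm_num,
      Real.rpow_one] at this
  have h3 : Real.log K ≤ 4 * (K : ℝ) ^ (1 / 4 : ℝ) := by
    have := Real.log_le_rpow_div hK0.le (by norm_num : (0 : ℝ) < 1 / 4)
    linarith
  have h4 : (K : ℝ) ^ (1 / 4 : ℝ) * (K : ℝ) ^ (3 / 4 : ℝ) = K := by
    rw [← Real.rpow_add hK0, show (1 / 4 : ℝ) + 3 / 4 = 1 by norm_num, Real.rpow_one]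
  rw [logStep_eq, div_le_iff₀ (by positivity)]
  rw [div_div, div_le_iff₀ (by positivity)] at h2
  calc 4 * Real.log K ≤ (K : ℝ) ^ (1 / 4 : ℝ) * 16 := by linarith
    _ ≤ (K : ℝ) ^ (1 / 4 : ℝ) * ((K : ℝ) ^ (3 / 4 : ℝ) * (μ * a * t)) := by gcongr
    _ = (K : ℝ) ^ (1 / 4 : ℝ) * (K : ℝ) ^ (3 / 4 : ℝ) * (μ * a * t) := by ring
    _ = a * t * (μ * K) := by rw [h4]; ring

/-- The constant in the convergence rate for the step size `logStep`. -/
noncomputable def rateConst (μ L : ℝ) : ℝ :=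
  324 * (32 * L / μ ^ 2 + 64 * L ^ 2 / μ ^ 3 + 256 * L ^ 4 / μ ^ 5) + 1728 * L / μ ^ 2

lemma rateConst_pos (hμ : 0 < μ) (hL : 0 < L) : 0 < rateConst μ L := by
  unfold rateConst
  positivity

/-- The number of iterations, in units of `max (n / (1 - λ)) (1 / (1 - λ) ^ (4/3))`, after which the
linear speedup sets in. -/
noncomputable def transientConst (μ L D : ℝ) : ℝ :=
  2 + |D| + (16 / (μ * stepFactor μ L)) ^ (4 / 3 : ℝ)

end LogStep

/-! ### Convergence rate and transient time -/

section Rates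

variable {n d : ℕ} {Ω : Type*} [MeasurableSpace Ω] {P : Measure Ω} [IsProbabilityMeasure P]
  {Ξ : Fin n → Type*} [∀ i, MeasurableSpace (Ξ i)]
  {W : Matrix (Fin n) (Fin n) ℝ} {f : Fin n → Vec d → ℝ}
  {F : (i : Fin n) → Vec d → Ξ i → ℝ} {ξ : (i : Fin n) → ℕ → Ω → Ξ i}
  {x0 : Vec d} {L μ σ : ℝ} {K : ℕ}

lemma zetaSq_nonneg : 0 ≤ zetaSq W f x0 :=
  mul_nonneg (by positivity) (Finset.sum_nonneg fun _ _ => by positivity)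

namespace StandingAssumptions

lemma expectedError_logStep_le (h : StandingAssumptions P W f F ξ x0 L μ σ (logStep μ K))
    (hs : StepSizeOK L μ (mixingRate W) (logStep μ K)) :
    expectedError P W f F ξ x0 (logStep μ K) K ≤
      2 * (avgCost f x0 - optValue f) / (K : ℝ) ^ 2 +
        rateConst μ L * Real.log K ^ 4 *
          (σ ^ 2 / (K * n) +
            mixingRate W ^ 4 * σ ^ 2 / ((K : ℝ) ^ 2 * (1 - mixingRate W)) +
            zetaSq W f x0 / ((K : ℝ) ^ 4 * (1 - mixingRate W) ^ 2) +
            mixingRate W ^ 4 * σ ^ 2 / ((K : ℝ) ^ 4 * (1 - mixingRate W) ^ 4 * n)) := by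
  have hn := h.one_le
  have hn' : (0 : ℝ) < n := by positivity
  have hL := h.smooth.pos
  have hμ := h.pl.pos
  have hK := two_le_of_logStep_pos hs.pos
  have hK0 : (0 : ℝ) < K := by positivity
  have hl := half_le_log hK
  obtain ⟨hlam0, hlam1, -⟩ := exists_modeBasis hn h.combination h.posSemidef
  have ht : 0 < 1 - mixingRate W := by linarith
  have hz := zetaSq_nonneg (W := W) (f := f) (x0 := x0)
  have hgap : 0 ≤ avgCost f x0 - optValue f := sub_nonneg.mpr (h.smooth.optValue_le x0)
  have hq : 0 ≤ 1 - logStep μ K * μ / 2 := by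
    have h1 := hs.le_first
    rw [le_div_iff₀ (by positivity)] at h1
    have h2 := mul_le_mul_of_nonneg_left h.mu_le hs.pos.le
    linarith
  have hpow := one_sub_logStep_pow_le hμ hK hq
  have hmain := h.expectedError_le hs K
  set t := 1 - mixingRate W with htdef
  set lam := mixingRate W
  set Z := zetaSq W f x0
  set ℓ := Real.log K with hℓ
  have hα := logStep_eq μ K
  rw [← hℓ] at hα
  have hl0 : 0 < ℓ := by linarith
  have hl2 : ℓ ^ 2 ≤ 4 * ℓ ^ 4 := by
    have := mul_le_mul_of_nonneg_left (pow_le_pow_left₀ (by norm_num) hl 2) (sq_nonneg ℓ)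
    linarith
  have hl1 : ℓ ≤ 8 * ℓ ^ 4 := by
    have := mul_le_mul_of_nonneg_left (pow_le_pow_left₀ (by norm_num) hl 3) hl0.le
    linarith
  set D1 := σ ^ 2 / (K * n) with hD1
  set D2 := lam ^ 4 * σ ^ 2 / ((K : ℝ) ^ 2 * t) with hD2
  set D3 := Z / ((K : ℝ) ^ 4 * t ^ 2) with hD3
  set D4 := lam ^ 4 * σ ^ 2 / ((K : ℝ) ^ 4 * t ^ 4 * n) with hD4
  have p1 : 0 ≤ D1 := by positivity
  have p2 : 0 ≤ D2 := by positivity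
  have p3 : 0 ≤ D3 := by positivity
  have p4 : 0 ≤ D4 := by positivity
  -- The factor `1/K²` from the geometric decay meets the `α²` in front of `ζ₀²`, which explains the
  -- `K⁴` in `D3`.
  have hinit : (1 - logStep μ K * μ / 2) ^ K * (2 * (avgCost f x0 - optValue f) +
      27 * logStep μ K ^ 2 * L * Z / t ^ 2) ≤
      2 * (avgCost f x0 - optValue f) / (K : ℝ) ^ 2 + 432 * L / μ ^ 2 * ℓ ^ 2 * D3 := by
    calc _ ≤ 1 / (K : ℝ) ^ 2 * (2 * (avgCost f x0 - optValue f) +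
          27 * logStep μ K ^ 2 * L * Z / t ^ 2) := by gcongr
      _ = _ := by
        rw [hα, hD3]
        field_simp
        ring
  have e1 : logStep μ K * L * σ ^ 2 / (μ * n) = 4 * L / μ ^ 2 * ℓ * D1 := by
    rw [hα, hD1]; field_simp
  have e2 : logStep μ K ^ 2 * L ^ 2 * lam ^ 4 * σ ^ 2 / (μ * t) =
      16 * L ^ 2 / μ ^ 3 * ℓ ^ 2 * D2 := by
    rw [hα, hD2]; field_simp; ring
  have e4 : logStep μ K ^ 4 * L ^ 4 * lam ^ 4 * σ ^ 2 / (μ * t ^ 4 * n) =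
      256 * L ^ 4 / μ ^ 5 * ℓ ^ 4 * D4 := by
    rw [hα, hD4]; field_simp; ring
  rw [e1, e2, e4] at hmain
  set A1 := L / μ ^ 2 with hA1
  set A2 := L ^ 2 / μ ^ 3 with hA2
  set A4 := L ^ 4 / μ ^ 5 with hA4
  have a1 : 0 ≤ A1 := by positivity
  have a2 : 0 ≤ A2 := by positivity
  have a4 : 0 ≤ A4 := by positivity
  have hC : rateConst μ L = 324 * (32 * A1 + 64 * A2 + 256 * A4) + 1728 * A1 := by
    rw [rateConst, hA1, hA2, hA4]; ring
  have b1 : 4 * L / μ ^ 2 * ℓ * D1 ≤ 32 * A1 * ℓ ^ 4 * D1 := by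
    calc 4 * L / μ ^ 2 * ℓ * D1 = 4 * A1 * ℓ * D1 := by rw [hA1]; ring
      _ ≤ 4 * A1 * (8 * ℓ ^ 4) * D1 := by gcongr
      _ = _ := by ring
  have b2 : 16 * L ^ 2 / μ ^ 3 * ℓ ^ 2 * D2 ≤ 64 * A2 * ℓ ^ 4 * D2 := by
    calc 16 * L ^ 2 / μ ^ 3 * ℓ ^ 2 * D2 = 16 * A2 * ℓ ^ 2 * D2 := by rw [hA2]; ring
      _ ≤ 16 * A2 * (4 * ℓ ^ 4) * D2 := by gcongr
      _ = _ := by ring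
  have b3 : 432 * L / μ ^ 2 * ℓ ^ 2 * D3 ≤ 1728 * A1 * ℓ ^ 4 * D3 := by
    calc 432 * L / μ ^ 2 * ℓ ^ 2 * D3 = 432 * A1 * ℓ ^ 2 * D3 := by rw [hA1]; ring
      _ ≤ 432 * A1 * (4 * ℓ ^ 4) * D3 := by gcongr
      _ = _ := by ring
  have b4 : 256 * L ^ 4 / μ ^ 5 * ℓ ^ 4 * D4 = 256 * A4 * ℓ ^ 4 * D4 := by rw [hA4]; ring
  have hfin : 1728 * A1 * ℓ ^ 4 * D3 + 324 * (32 * A1 * ℓ ^ 4 * D1 + 64 * A2 * ℓ ^ 4 * D2 +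
      256 * A4 * ℓ ^ 4 * D4) ≤ rateConst μ L * ℓ ^ 4 * (D1 + D2 + D3 + D4) := by
    calc _ = 1728 * A1 * ℓ ^ 4 * D3 + 324 * (32 * A1) * ℓ ^ 4 * D1 +
          324 * (64 * A2) * ℓ ^ 4 * D2 + 324 * (256 * A4) * ℓ ^ 4 * D4 := by ring
      _ ≤ rateConst μ L * ℓ ^ 4 * D3 + rateConst μ L * ℓ ^ 4 * D1 +
          rateConst μ L * ℓ ^ 4 * D2 + rateConst μ L * ℓ ^ 4 * D4 := by
        rw [hC]
        gcongr <;> linarith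
      _ = _ := by ring
  rw [b4] at hmain
  linarith

omit [IsProbabilityMeasure P] in
lemma stepSizeOK_logStep {α : ℝ} (h : StandingAssumptions P W f F ξ x0 L μ σ α) {D : ℝ}
    (hK : transientConst μ L D *
      max (n / (1 - mixingRate W)) (1 / (1 - mixingRate W) ^ (4 / 3 : ℝ)) ≤ K) :
    2 ≤ K ∧ StepSizeOK L μ (mixingRate W) (logStep μ K) := by
  have hn := h.one_le
  have hL := h.smooth.pos
  have hμ := h.pl.pos
  obtain ⟨hlam0, hlam1, -⟩ := exists_modeBasis hn h.combination h.posSemidef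
  have ht : 0 < 1 - mixingRate W := by linarith
  have ha := stepFactor_pos hμ hL
  set M := max (n / (1 - mixingRate W)) (1 / (1 - mixingRate W) ^ (4 / 3 : ℝ)) with hM
  have hM1 : 1 ≤ M := by
    refine le_trans ?_ (le_max_left _ _)
    rw [one_le_div ht]
    have : (1 : ℝ) ≤ n := by exact_mod_cast hn
    linarith
  have hb : 0 ≤ (16 / (μ * stepFactor μ L)) ^ (4 / 3 : ℝ) := by positivity
  have hK2 : 2 ≤ K := by
    have : (2 : ℝ) ≤ K := by
      refine le_trans ?_ hK
      calc (2 : ℝ) = 2 * 1 := by ring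
        _ ≤ transientConst μ L D * M := by
          have : 2 ≤ transientConst μ L D := by
            unfold transientConst; linarith [abs_nonneg D]
          gcongr
    exact_mod_cast this
  refine ⟨hK2, stepSizeOK_of_le hμ hL hlam0 hlam1 ?_ (logStep_le_of_rpow_le hμ ha ht hK2 ?_)⟩
  · have := half_le_log hK2
    rw [logStep_eq]
    have hK0 : (0 : ℝ) < K := by positivity
    have : 0 < Real.log K := by linarith
    positivity
  · refine le_trans ?_ hK
    have : (16 / (μ * stepFactor μ L)) ^ (4 / 3 : ℝ) ≤ transientConst μ L D := by
      unfold transientConst; linarith [abs_nonneg D]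
    exact mul_le_mul this (le_max_right _ _) (by positivity) (hb.trans this)

/-- Each remaining term is compared with `σ² / (n K)`. The initial gap needs `|D| n ≤ K`, the `λ⁴/(1
- λ)` term needs `n ≤ K t`, the `ζ₀²` term needs `|D| n ≤ K t` and `1 ≤ K t`, and the last term
needs `1 ≤ K³ t⁴`. -/
lemma expectedError_le_linear_speedup
    (h : StandingAssumptions P W f F ξ x0 L μ σ (logStep μ K)) {D : ℝ}
    (hK : transientConst μ L D *
      max (n / (1 - mixingRate W)) (1 / (1 - mixingRate W) ^ (4 / 3 : ℝ)) ≤ K)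
    (hf0 : avgCost f x0 - optValue f ≤ D * σ ^ 2) (hz0 : zetaSq W f x0 ≤ D * σ ^ 2) :
    expectedError P W f F ξ x0 (logStep μ K) K ≤
      (32 + 4 * rateConst μ L) * Real.log K ^ 4 * (σ ^ 2 / (n * K)) := by
  obtain ⟨hK2, hs⟩ := h.stepSizeOK_logStep hK
  have hmain := h.expectedError_logStep_le hs
  have hn := h.one_le
  have hn' : (0 : ℝ) < n := by positivity
  have hL := h.smooth.pos
  have hμ := h.pl.pos
  obtain ⟨hlam0, hlam1, -⟩ := exists_modeBasis hn h.combination h.posSemidef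
  have hC := rateConst_pos hμ hL
  have hb : 0 ≤ (16 / (μ * stepFactor μ L)) ^ (4 / 3 : ℝ) := by
    have := stepFactor_pos hμ hL
    positivity
  have hK1 : (1 : ℝ) ≤ K := by exact_mod_cast (by omega : 1 ≤ K)
  have hK0 : (0 : ℝ) < K := by linarith
  have hlam4 : mixingRate W ^ 4 ≤ 1 := pow_le_one₀ hlam0 hlam1.le
  have hl := half_le_log hK2
  set t := 1 - mixingRate W with htdef
  have ht : 0 < t := by linarith
  have ht1 : t ≤ 1 := by linarith
  have hone : (1 + |D|) ≤ transientConst μ L D := by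
    unfold transientConst; linarith [abs_nonneg D]
  have hD0 := abs_nonneg D
  have hKa : (1 + |D|) * (n / t) ≤ K := by
    refine le_trans ?_ hK
    exact mul_le_mul hone (le_max_left _ _) (by positivity) (by linarith)
  have hKb : 1 / t ^ (4 / 3 : ℝ) ≤ K := by
    refine le_trans ?_ hK
    calc 1 / t ^ (4 / 3 : ℝ) = 1 * (1 / t ^ (4 / 3 : ℝ)) := by ring
      _ ≤ transientConst μ L D * max (n / t) (1 / t ^ (4 / 3 : ℝ)) := by
        exact mul_le_mul (by linarith) (le_max_right _ _) (by positivity) (by linarith)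
  have hnt : n / t ≤ K := le_trans (le_mul_of_one_le_left (by positivity) (by linarith)) hKa
  have hDn : |D| * (n / t) ≤ K :=
    le_trans (mul_le_mul_of_nonneg_right (by linarith) (by positivity)) hKa
  have hDσ : D * σ ^ 2 ≤ |D| * σ ^ 2 := mul_le_mul_of_nonneg_right (le_abs_self D) (sq_nonneg σ)
  have hKt : 1 ≤ K * t := by
    rw [div_le_iff₀ ht] at hnt
    have : (1 : ℝ) ≤ n := by exact_mod_cast hn
    linarith
  have hDn' : |D| * n ≤ K * t := by
    rw [← mul_div_assoc, div_le_iff₀ ht] at hDn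
    exact hDn
  -- The cube of `1 ≤ K t^(4/3)`; this term is what produces the exponent `4/3` in the transient
  -- time.
  have hKt4 : 1 ≤ (K : ℝ) ^ 3 * t ^ 4 := by
    rw [div_le_iff₀ (by positivity)] at hKb
    have h1 := one_le_pow₀ hKb (n := 3)
    rw [mul_pow, ← Real.rpow_natCast (t ^ (4 / 3 : ℝ)) 3, ← Real.rpow_mul ht.le] at h1
    have e : (4 / 3 : ℝ) * ((3 : ℕ) : ℝ) = ((4 : ℕ) : ℝ) := by norm_num
    rwa [e, Real.rpow_natCast] at h1
  set S := σ ^ 2 / (n * K) with hS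
  have hS0 : 0 ≤ S := by positivity
  have d0 : 2 * (avgCost f x0 - optValue f) / (K : ℝ) ^ 2 ≤ 2 * S := by
    rw [hS, ← mul_div_assoc, div_le_div_iff₀ (by positivity) (by positivity)]
    have h1 : (avgCost f x0 - optValue f) * (n * K) ≤ |D| * σ ^ 2 * (n * K) := by
      gcongr
      linarith
    have h2 : |D| * n * (σ ^ 2 * K) ≤ K * (σ ^ 2 * K) := by
      gcongr
      exact hDn'.trans (mul_le_of_le_one_right hK0.le ht1)
    linarith
  have d1 : σ ^ 2 / (K * n) = S := by rw [hS, mul_comm (K : ℝ)]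
  have d2 : mixingRate W ^ 4 * σ ^ 2 / ((K : ℝ) ^ 2 * t) ≤ S := by
    rw [hS, div_le_div_iff₀ (by positivity) (by positivity)]
    rw [div_le_iff₀ ht] at hnt
    calc mixingRate W ^ 4 * σ ^ 2 * (n * K) ≤ 1 * σ ^ 2 * (K * t * K) := by gcongr
      _ = _ := by ring
  have d3 : zetaSq W f x0 / ((K : ℝ) ^ 4 * t ^ 2) ≤ S := by
    rw [hS, div_le_div_iff₀ (by positivity) (by positivity)]
    calc zetaSq W f x0 * (n * K) ≤ |D| * σ ^ 2 * (n * K) := by gcongr; linarith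
      _ = σ ^ 2 * K * (|D| * n) * 1 * 1 := by ring
      _ ≤ σ ^ 2 * K * (K * t) * (K * t) * K := by gcongr
      _ = _ := by ring
  have d4 : mixingRate W ^ 4 * σ ^ 2 / ((K : ℝ) ^ 4 * t ^ 4 * n) ≤ S := by
    rw [hS, div_le_div_iff₀ (by positivity) (by positivity)]
    calc mixingRate W ^ 4 * σ ^ 2 * (n * K) ≤ 1 * σ ^ 2 * (n * K) := by gcongr
      _ = σ ^ 2 * n * K * 1 := by ring
      _ ≤ σ ^ 2 * n * K * ((K : ℝ) ^ 3 * t ^ 4) := by gcongr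
      _ = _ := by ring
  have hl4 : 1 ≤ 16 * Real.log K ^ 4 := by
    have := pow_le_pow_left₀ (by norm_num) hl 4
    norm_num at this
    linarith
  calc expectedError P W f F ξ x0 (logStep μ K) K ≤ _ := hmain
    _ ≤ 2 * S + rateConst μ L * Real.log K ^ 4 * (S + S + S + S) := by
      rw [d1]
      have : 0 ≤ Real.log K := by linarith
      gcongr
    _ ≤ 2 * (16 * Real.log K ^ 4) * S + rateConst μ L * Real.log K ^ 4 * (S + S + S + S) := by
      gcongr
      linarith
    _ = _ := by ring

end StandingAssumptions

end Rates

theorem corollary4 :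
    -- the bound after `k` iterations, with a universal constant
    (∃ C : ℝ, 0 < C ∧
      ∀ (n d : ℕ) (Ω : Type u) [MeasurableSpace Ω] (P : Measure Ω) [IsProbabilityMeasure P]
        (Ξ : Fin n → Type v) [∀ i, MeasurableSpace (Ξ i)]
        (W : Matrix (Fin n) (Fin n) ℝ) (f : Fin n → Vec d → ℝ)
        (F : (i : Fin n) → Vec d → Ξ i → ℝ) (ξ : (i : Fin n) → ℕ → Ω → Ξ i)
        (x0 : Vec d) (L μ σ α : ℝ),
        StandingAssumptions P W f F ξ x0 L μ σ α →
        StepSizeOK L μ (mixingRate W) α →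
        ∀ k : ℕ,
          (∀ i, Integrable (fun ω => avgCost f (atcGTIterate W F ξ x0 α k ω i)) P) ∧
          expectedError P W f F ξ x0 α k ≤
            (1 - α * μ / 2) ^ k *
                (2 * (avgCost f x0 - optValue f) +
                  27 * α ^ 2 * L * zetaSq W f x0 / (1 - mixingRate W) ^ 2) +
              C * (α * L * σ ^ 2 / (μ * n) +
                α ^ 2 * L ^ 2 * mixingRate W ^ 4 * σ ^ 2 / (μ * (1 - mixingRate W)) +
                α ^ 4 * L ^ 4 * mixingRate W ^ 4 * σ ^ 2 / (μ * (1 - mixingRate W) ^ 4 * n))) ∧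
    -- the rate for the step size `2 ln(K²) / (μ K)`; the hidden factor is a constant depending on
    -- `μ` and `L` only, times a fixed power of `ln K`
    (∃ (p : ℕ) (C : ℝ → ℝ → ℝ),
      ∀ (n d : ℕ) (Ω : Type u) [MeasurableSpace Ω] (P : Measure Ω) [IsProbabilityMeasure P]
        (Ξ : Fin n → Type v) [∀ i, MeasurableSpace (Ξ i)]
        (W : Matrix (Fin n) (Fin n) ℝ) (f : Fin n → Vec d → ℝ)
        (F : (i : Fin n) → Vec d → Ξ i → ℝ) (ξ : (i : Fin n) → ℕ → Ω → Ξ i)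
        (x0 : Vec d) (L μ σ : ℝ) (K : ℕ),
        StandingAssumptions P W f F ξ x0 L μ σ (logStep μ K) →
        StepSizeOK L μ (mixingRate W) (logStep μ K) →
        expectedError P W f F ξ x0 (logStep μ K) K ≤
          2 * (avgCost f x0 - optValue f) / (K : ℝ) ^ 2 +
            C μ L * Real.log K ^ p *
              (σ ^ 2 / (K * n) +
                mixingRate W ^ 4 * σ ^ 2 / ((K : ℝ) ^ 2 * (1 - mixingRate W)) +
                zetaSq W f x0 / ((K : ℝ) ^ 4 * (1 - mixingRate W) ^ 2) +
                mixingRate W ^ 4 * σ ^ 2 / ((K : ℝ) ^ 4 * (1 - mixingRate W) ^ 4 * n))) ∧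
    -- the transient time: after order `max {n / (1 - λ), 1 / (1 - λ)^(4/3)}` iterations the
    -- step size is admissible and the linear-speedup term `σ² / (n K)` dominates
    (∃ (p : ℕ) (C : ℝ → ℝ → ℝ) (c : ℝ → ℝ → ℝ → ℝ),
      ∀ (n d : ℕ) (Ω : Type u) [MeasurableSpace Ω] (P : Measure Ω) [IsProbabilityMeasure P]
        (Ξ : Fin n → Type v) [∀ i, MeasurableSpace (Ξ i)]
        (W : Matrix (Fin n) (Fin n) ℝ) (f : Fin n → Vec d → ℝ)
        (F : (i : Fin n) → Vec d → Ξ i → ℝ) (ξ : (i : Fin n) → ℕ → Ω → Ξ i)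
        (x0 : Vec d) (L μ σ D : ℝ) (K : ℕ),
        StandingAssumptions P W f F ξ x0 L μ σ (logStep μ K) →
        c μ L D * max (n / (1 - mixingRate W)) (1 / (1 - mixingRate W) ^ (4 / 3 : ℝ)) ≤ K →
        StepSizeOK L μ (mixingRate W) (logStep μ K) ∧
          (avgCost f x0 - optValue f ≤ D * σ ^ 2 → zetaSq W f x0 ≤ D * σ ^ 2 →
            expectedError P W f F ξ x0 (logStep μ K) K ≤
              C μ L * Real.log K ^ p * (σ ^ 2 / (n * K)))) := by
  refine ⟨⟨324, by norm_num, ?_⟩, ⟨4, rateConst, ?_⟩,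
    ⟨4, fun μ L => 32 + 4 * rateConst μ L, transientConst, ?_⟩⟩
  · intro n d Ω _ P _ Ξ _ W f F ξ x0 L μ σ α h hs k
    exact ⟨h.integrable_avgCost_iterate hs.pos.ne' k, h.expectedError_le hs k⟩
  · intro n d Ω _ P _ Ξ _ W f F ξ x0 L μ σ K h hs
    exact h.expectedError_logStep_le hs
  · intro n d Ω _ P _ Ξ _ W f F ξ x0 L μ σ D K h hK
    exact ⟨(h.stepSizeOK_logStep hK).2, h.expectedError_le_linear_speedup hK⟩
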